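/- **Conventions.** Write $[n]=\{1,\dots,n\}$ and $\binom{I}{d}$ for the set of $d$-element subsets of $I$. A $d$-dimensional random array on $[n]$ with values in a finite set $\mathcal X$ is a family $\boldsymbol X=\langle X_s:s\in\binom{[n]}{d}\rangle$ of $\mathcal X$-valued random variables on a common probability space; it is *$\eta$-spreadable* if for all $K,L\subseteq[n]$ with $|K|=|L|\ge d$ the laws of the subarrays $\langle X_s:s\in\binom Kd\rangle$ and $\langle X_s:s\in\binom Ld\rangle$ (identified via the increasing bijection $K\to L$) are at total variation distance at most $\eta$. A *box* is a set of the form $B=\{s\in\binom{[n]}d: |s\cap H_i|=1 \text{ for all } i\in[d]\}$, where $H_1,\dots,H_d\subseteq[n]$ are $2$-element sets with $\max H_i<\min H_{i+1}$ for $1\le i<d$. The array $\boldsymbol X$ is *$\vartheta$-box independent* if there is $\mathcal S\subseteq\mathcal X$ with $|\mathcal S|=|\mathcal X|-1$ such that for every box $B$ and every $a\in\mathcal S$ $$\Big|\mathbb P\Big(\bigcap_{s\in B}[X_s=a]\Big)-\prod_{s\in B}\mathbb P(X_s=a)\Big|\le\vartheta .$$ For a probability measure $\mu$ on a finite set $\Omega$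 and $h:\Omega^d\to\mathbb R$, let $\mathbb E[h]$ be the mean of $h$ with respect to the product measure $\mu^d$, and let $$\|h\|_\square=\Big(\int\prod_{\epsilon\in\{0,1\}^d}h(\omega_1^{\epsilon_1},\dots,\omega_d^{\epsilon_d})\,d\mu^{2d}(\omega_1^0,\omega_1^1,\dots,\omega_d^0,\omega_d^1)\Big)^{1/2^d}.$$ **Setting.** Let $d,m\ge2$ be integers, let $0<\varepsilon\le1$, and set $$C=\exp^{(2d)}\Big(\frac{2^8m^{7(2d)^d}}{\varepsilon^2}\Big),$$ where $\exp^{(\ell)}$ is the $\ell$-fold iterated exponential. Let $n\ge C$ be an integer, let $|\mathcal X|=m$, and let $\boldsymbol X$ be an $\mathcal X$-valued, $(1/C)$-spreadable, $d$-dimensional random array on $[n]$. Set $\delta_a=\mathbb P(X_{[d]}=a)$ for $a\in\mathcal X$. Suppose that the following are given: nonempty finite sets $J,\Omega$ with $|J|,|\Omega|\le C$; positive reals $(\lambda_j)_{j\in J}$ with $\sum_{j\in J}\lambda_j=1$; and, for each $j\in J$, a probability measure $\mu_j$ on $\Omega$ and functions $h_j^a:\Omega^d\to[0,1]$ $(a\in\mathcal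 X)$ with $\sum_{a\in\mathcal X} h^a_j=1$ $\mu_j^d$-almost surely. Suppose moreover that for every $L\subseteq[n]$ with $|L|=2d$ the law of $\langle X_s:s\in\binom Ld\rangle$ is at total variation distance at most $\varepsilon$ from the probability measure $Q_L$ on $\mathcal X^{\binom Ld}$ given by $$Q_L\big(\{(a_s)_{s}\}\big)=\sum_{j\in J}\lambda_j\int\prod_{s\in\binom Ld}h_j^{a_s}(\omega_{i_1},\dots,\omega_{i_d})\,d\boldsymbol\mu_j(\omega)\qquad(s=\{i_1<\dots<i_d\}),$$ where $\boldsymbol\mu_j$ is the law of a family $(\omega_i)_i$ of independent points with law $\mu_j$. **Proposition 8.3.** For $\varrho>0$ consider the statement $(\ast)_\varrho$: there is $G\subseteq J$ with $\sum_{j\in G}\lambda_j\ge1-\varrho$ such that for every $j\in G$ and every $a\in\mathcal X$ we have $|\mathbb E[h^a_j]-\delta_a|\le\varrho$ and $\big\|h^a_j-\mathbb E[h^a_j]\big\|_\square\le\varrho$. 1. For every $\varrho>0$: if $(\ast)_\varrho$ holds, then $\boldsymbol X$ is $\vartheta$-box independent with $\vartheta=2^d(2\varepsilon+4\varrho)$.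 2. For every $\vartheta>0$: if $\boldsymbol X$ is $\vartheta$-box independent, then $(\ast)_\varrho$ holds with $\varrho=2^{d+7}m^3\big(\varepsilon^{1/12^d}+\vartheta^{1/12^d}\big)$. -/

import Mathlib

open MeasureTheory

noncomputable section

namespace RandomArray

/-- The `d`-element subsets of `I`. A `d`-dimensional random array on `I` with values in `𝒳`, on the
probability space `(Ω₀, P)`, is a family `X : DSubset I d → Ω₀ → 𝒳` of random variables. -/
abbrev DSubset (I : Type*) (d : ℕ) : Type _ := {s : Finset I // s.card = d}

/-- The set of `d`-element subsets of `I` that are contained in `L`, as a finset. -/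
def subsetsOf {I : Type*} (d : ℕ) (L : Finset I) : Finset (DSubset I d) :=
  (L.powersetCard d).subtype fun s => s.card = d

/-- The image of a `d`-element subset of `Fin r` under the increasing enumeration of an
`r`-element set `J`. -/
def relabel {I : Type*} [LinearOrder I] {d r : ℕ} (J : Finset I) (hJ : J.card = r)
    (s : DSubset (Fin r) d) : DSubset I d :=
  ⟨s.1.map (J.orderEmbOfFin hJ).toEmbedding, by rw [Finset.card_map, s.2]⟩

/-- The total variation distance `sup_A |P(A) - Q(A)|` of two probability measures. -/
def tvDist {E : Type*} [MeasurableSpace E] (P Q : Measure E) : ℝ :=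
  ⨆ A : {A : Set E // MeasurableSet A}, |P.real A.1 - Q.real A.1|

/-- The law of the subarray of `X` determined by the `r`-element set `J`, where `J` is
identified with `Fin r` by its increasing enumeration (so that the laws of the subarrays
determined by two sets of the same size live on the same space). -/
def subarrayLaw {I Ω₀ 𝒳 : Type*} [LinearOrder I] [MeasurableSpace Ω₀] [MeasurableSpace 𝒳]
    {d r : ℕ} (P : Measure Ω₀) (X : DSubset I d → Ω₀ → 𝒳) (J : Finset I) (hJ : J.card = r) :
    Measure (DSubset (Fin r) d → 𝒳) :=
  P.map fun ω s => X (relabel J hJ s) ω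

/-- `η`-spreadability. -/
def IsSpreadable {I Ω₀ 𝒳 : Type*} [LinearOrder I] [MeasurableSpace Ω₀] [MeasurableSpace 𝒳]
    {d : ℕ} (P : Measure Ω₀) (X : DSubset I d → Ω₀ → 𝒳) (η : ℝ) : Prop :=
  ∀ (r : ℕ), d ≤ r → ∀ (J K : Finset I) (hJ : J.card = r) (hK : K.card = r),
    tvDist (subarrayLaw P X J hJ) (subarrayLaw P X K hK) ≤ η

/-- The joint law of the variables `X s`, `s ∈ F`. -/
def jointLaw {I Ω₀ 𝒳 : Type*} [MeasurableSpace Ω₀] [MeasurableSpace 𝒳]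
    {d : ℕ} (P : Measure Ω₀) (X : DSubset I d → Ω₀ → 𝒳) (F : Finset (DSubset I d)) :
    Measure (F → 𝒳) :=
  P.map fun ω s => X s.1 ω

/-- `𝓗 = (h a)_a` is an `𝒳`-partition of unity on `Ω ^ d`. -/
structure IsPartitionOfUnity {Ω 𝒳 : Type*} [MeasurableSpace Ω] [Fintype 𝒳] {d : ℕ}
    (μ : Measure Ω) (h : 𝒳 → (Fin d → Ω) → ℝ) : Prop where
  measurable : ∀ a, Measurable (h a)
  mem_Icc : ∀ a x, h a x ∈ Set.Icc (0 : ℝ) 1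
  sum_eq_one : ∀ᵐ x ∂(Measure.pi fun _ : Fin d => μ), ∑ a, h a x = 1

/-- The restriction `ω_s = (ω_{i_1}, …, ω_{i_d})` of `ω` to the coordinates in
`s = {i_1 < ⋯ < i_d}`. -/
def coords {I Ω : Type*} [LinearOrder I] {d : ℕ} (ω : I → Ω) (s : DSubset I d) : Fin d → Ω :=
  fun i => ω (s.1.orderEmbOfFin s.2 i)

/-- The finite-dimensional distribution on the finite set `F` of `d`-element sets of the random
array `X_{λ,𝓗}`: the probability that `X_s = a s` for all `s ∈ F` is
`∑ j, λ_j ∫ ∏_{s ∈ F} h_j^{a_s}(ω_s) dμ_j(ω)`, where `ω = (ω_i)_i` are i.i.d. with law `μ_j`. -/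
def mixtureLaw {I J Ω 𝒳 : Type*} [LinearOrder I] [Fintype J] [MeasurableSpace Ω] [Fintype 𝒳]
    [MeasurableSpace 𝒳] {d : ℕ} (lam : J → ℝ) (μ : J → Measure Ω) [∀ j, IsProbabilityMeasure (μ j)]
    (h : J → 𝒳 → (Fin d → Ω) → ℝ) (F : Finset (DSubset I d)) : Measure (F → 𝒳) :=
  ∑ a : F → 𝒳,
    ENNReal.ofReal (∑ j, lam j *
      ∫ ω : I → Ω, ∏ s : F, h j (a s) (coords ω s.1) ∂(Measure.infinitePi fun _ : I => μ j)) •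
    Measure.dirac a

/-- The mean of a random variable on `Ω ^ d`. -/
def mean {Ω : Type*} [MeasurableSpace Ω] {d : ℕ} (μ : Measure Ω) (f : (Fin d → Ω) → ℝ) : ℝ :=
  ∫ x, f x ∂(Measure.pi fun _ : Fin d => μ)

/-- The box norm of a bounded random variable on `Ω ^ d`; a point of `Ω ^ {2d}` is written as
`(ω (i, e))` with `i : Fin d` and `e : Bool`. -/
def boxNorm {Ω : Type*} [MeasurableSpace Ω] {d : ℕ} (μ : Measure Ω) (f : (Fin d → Ω) → ℝ) : ℝ :=
  (∫ ω : Fin d × Bool → Ω, ∏ e : Fin d → Bool, f (fun i => ω (i, e i))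
    ∂(Measure.pi fun _ : Fin d × Bool => μ)) ^ ((1 : ℝ) / 2 ^ d)

/-- `d`-dimensional boxes of `[n]`. -/
def IsBox {n d : ℕ} (B : Finset (DSubset (Fin n) d)) : Prop :=
  ∃ H : Fin d → Finset (Fin n),
    (∀ i, (H i).card = 2) ∧
    (∀ i i' : Fin d, i.val + 1 = i'.val → ∀ x ∈ H i, ∀ y ∈ H i', x < y) ∧
    ∀ s, s ∈ B ↔ ∀ i, (s.1 ∩ H i).card = 1

/-- The `ϑ`-box independence condition. -/
def BoxIndependent {Ω₀ 𝒳 : Type*} [MeasurableSpace Ω₀] [Fintype 𝒳] {n d : ℕ}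
    (P : Measure Ω₀) (X : DSubset (Fin n) d → Ω₀ → 𝒳) (θ : ℝ) : Prop :=
  ∃ S : Finset 𝒳, S.card + 1 = Fintype.card 𝒳 ∧
    ∀ B : Finset (DSubset (Fin n) d), IsBox B → ∀ a ∈ S,
      |P.real (⋂ s ∈ B, {ω | X s ω = a}) - ∏ s ∈ B, P.real {ω | X s ω = a}| ≤ θ

/-- The set `[d]` of the first `d` elements of `[n]`. -/
def initial {n d : ℕ} (hdn : d ≤ n) : DSubset (Fin n) d :=
  ⟨Finset.univ.map (Fin.castLEEmb hdn), by simp⟩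

/-- The constant `C(d, m, k, ε)`, a `2d`-fold iterated exponential. -/
def bigC (d m k : ℕ) (ε : ℝ) : ℝ :=
  Real.exp^[2 * d] (2 ^ 8 * (m : ℝ) ^ (7 * k ^ d) / ε ^ 2)

/-- For every `j ∈ G` and every `a`, the mean of `h_j^a` is `ϱ`-close to `δ a`, and `h_j^a` is
`ϱ`-box uniform; moreover `G` has `λ`-mass at least `1 - ϱ`. -/
def IsUniformSet {J Ω 𝒳 : Type*} [MeasurableSpace Ω] {d : ℕ} (lam : J → ℝ) (μ : J → Measure Ω)
    (h : J → 𝒳 → (Fin d → Ω) → ℝ) (δ : 𝒳 → ℝ) (ρ : ℝ) (G : Finset J) : Prop :=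
  1 - ρ ≤ ∑ j ∈ G, lam j ∧
    ∀ j ∈ G, ∀ a, |mean (μ j) (h j a) - δ a| ≤ ρ ∧
      boxNorm (μ j) (fun x => h j a x - mean (μ j) (h j a)) ≤ ρ

end RandomArray

end

/-! A box spans a `2d`-element set, and the integral of `h_j^a` multiplied over its `2^d` corners is
the `2^d`-th power of the box norm of `h_j^a`. So, up to `ε`, the probability that `X_s = a`
throughout a box is the `λ`-average of these powers (`IsBox.approx`). By spreadability all marginals
are within `1/C` of `δ a`, so their product over a box is about `(δ a)^(2^d)`.

If most `h_j^a` are box uniform with mean near `δ a`, the triangle inequality puts their box powers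
near `(δ a)^(2^d)` (`abs_boxPow_sub_avg_pow_le`), which gives box independence.

Conversely, box independence on a single box says that the box powers average to at most about `(δ
a)^(2^d)`, while the means average to about `δ a`. Since `E[h]^(2^d)` never exceeds the box power,
this is nearly the minimum, and near-minimality forces `h_j^a` to be close to the constant `δ a` for
most `j`, as for quasirandom graphs with few 4-cycles. The quantitative form is `sum_boxPow_sub_le`,
by induction on the dimension: near-minimality passes to the sections `f(x,·)`, with target `p`, and
to the products `f(x,·) f(x',·)`, with target `p^2`. The bounds for both recombine through
`(u-p)(v-p) = (uv-p^2) - p(u-p) - p(v-p)`. Markov's inequality then selects `G`, and the value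
outside `S` is handled by `∑ a, h_j^a = 1`. -/

noncomputable section

namespace RandomArray

set_option linter.unusedSectionVars false

/-! ### Box norms over weighted finite sets, without roots. -/

section Basic

variable {Z Ω : Type*} [Fintype Z] [Fintype Ω] {d : ℕ}

/-- The weighted sum of `F` over `Z ^ d`, for product weights. -/
def avg (w : Z → ℝ) (F : (Fin d → Z) → ℝ) : ℝ := ∑ y, (∏ i, w (y i)) * F y

/-- The product weights on `Ω × Ω`. -/
def pairWeight (w : Ω → ℝ) (z : Bool → Ω) : ℝ := w (z false) * w (z true)

/-- The `2 ^ d`-th power of the box norm, as a finite sum. -/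
def boxPow (w : Ω → ℝ) (f : (Fin d → Ω) → ℝ) : ℝ :=
  avg (pairWeight w) fun y => ∏ e : Fin d → Bool, f fun i => y i (e i)

/-- The average of `boxPow` over the products of a section of `f` and a section of `g`. -/
def boxPair (w : Ω → ℝ) (f g : (Fin (d + 1) → Ω) → ℝ) : ℝ :=
  ∑ x, ∑ x', w x * w x' * boxPow w fun y => f (Fin.cons x y) * g (Fin.cons x' y)

lemma avg_zero (w : Z → ℝ) (F : (Fin 0 → Z) → ℝ) : avg w F = F Fin.elim0 := by
  simp only [avg, Finset.univ_unique, Finset.univ_eq_empty, Finset.prod_empty, one_mul,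
    Finset.sum_singleton]
  congr 1

lemma avg_succ (w : Z → ℝ) (F : (Fin (d + 1) → Z) → ℝ) :
    avg w F = ∑ z, w z * avg w fun y => F (Fin.cons z y) := by
  unfold avg
  rw [← (Fin.consEquiv fun _ => Z).sum_comp, Fintype.sum_prod_type]
  refine Finset.sum_congr rfl fun z _ => ?_
  rw [Finset.mul_sum]
  refine Finset.sum_congr rfl fun y _ => ?_
  simp only [Fin.consEquiv_apply, Fin.prod_univ_succ, Fin.cons_zero, Fin.cons_succ]
  rw [mul_assoc]
  rfl

lemma avg_congr {w : Z → ℝ} {F G : (Fin d → Z) → ℝ}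
    (h : ∀ y, (∀ i, w (y i) ≠ 0) → F y = G y) : avg w F = avg w G := by
  refine Finset.sum_congr rfl fun y _ => ?_
  by_cases hy : ∏ i, w (y i) = 0
  · simp [hy]
  · rw [h y fun i hi => hy (Finset.prod_eq_zero (Finset.mem_univ i) hi)]

lemma avg_sum {ι : Type*} (s : Finset ι) (w : Z → ℝ) (F : ι → (Fin d → Z) → ℝ) :
    avg w (fun y => ∑ a ∈ s, F a y) = ∑ a ∈ s, avg w (F a) := by
  simp only [avg, Finset.mul_sum]
  exact Finset.sum_comm

lemma avg_const_mul (w : Z → ℝ) (c : ℝ) (F : (Fin d → Z) → ℝ) :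
    avg w (fun y => c * F y) = c * avg w F := by
  simp only [avg, Finset.mul_sum]
  exact Finset.sum_congr rfl fun y _ => by ring

lemma avg_sub (w : Z → ℝ) (F G : (Fin d → Z) → ℝ) :
    avg w (fun y => F y - G y) = avg w F - avg w G := by
  simp only [avg, mul_sub, Finset.sum_sub_distrib]

lemma sum_prod_eq_one {w : Z → ℝ} (hw1 : ∑ z, w z = 1) :
    ∑ y : Fin d → Z, ∏ i, w (y i) = 1 := by
  classical
  have := Finset.prod_univ_sum (fun _ : Fin d => (Finset.univ : Finset Z)) fun _ z => w z
  simp only [hw1, Finset.prod_const_one, Fintype.piFinset_univ] at this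
  exact this.symm

lemma avg_const {w : Z → ℝ} (hw1 : ∑ z, w z = 1) (c : ℝ) :
    avg w (fun _ : Fin d → Z => c) = c := by
  rw [avg, ← Finset.sum_mul, sum_prod_eq_one hw1, one_mul]

lemma avg_mono {w : Z → ℝ} (hw : ∀ z, 0 ≤ w z) {F G : (Fin d → Z) → ℝ} (h : ∀ y, F y ≤ G y) :
    avg w F ≤ avg w G :=
  Finset.sum_le_sum fun y _ =>
    mul_le_mul_of_nonneg_left (h y) (Finset.prod_nonneg fun _ _ => hw _)

lemma avg_nonneg {w : Z → ℝ} (hw : ∀ z, 0 ≤ w z) {F : (Fin d → Z) → ℝ} (h : ∀ y, 0 ≤ F y) :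
    0 ≤ avg w F :=
  Finset.sum_nonneg fun y _ => mul_nonneg (Finset.prod_nonneg fun _ _ => hw _) (h y)

lemma avg_mul_sq_le {w : Z → ℝ} (hw : ∀ z, 0 ≤ w z) (F G : (Fin d → Z) → ℝ) :
    avg w (fun y => F y * G y) ^ 2 ≤ avg w (fun y => F y ^ 2) * avg w (fun y => G y ^ 2) := by
  have hp : ∀ y : Fin d → Z, 0 ≤ ∏ i, w (y i) := fun y => Finset.prod_nonneg fun _ _ => hw _
  refine Finset.sum_sq_le_sum_mul_sum_of_sq_le_mul _ (fun y _ => mul_nonneg (hp y) (sq_nonneg _))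
    (fun y _ => mul_nonneg (hp y) (sq_nonneg _)) fun y _ => le_of_eq (by ring)

lemma avg_pow_le {w : Z → ℝ} (hw : ∀ z, 0 ≤ w z) (hw1 : ∑ z, w z = 1) (F : (Fin d → Z) → ℝ)
    {k : ℕ} (hk : Even k) : avg w F ^ k ≤ avg w fun y => F y ^ k :=
  Real.pow_arith_mean_le_arith_mean_pow_of_even _ _ _
    (fun _ _ => Finset.prod_nonneg fun _ _ => hw _) (sum_prod_eq_one hw1) hk

lemma pairWeight_nonneg {w : Ω → ℝ} (hw : ∀ z, 0 ≤ w z) (z : Bool → Ω) : 0 ≤ pairWeight w z :=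
  mul_nonneg (hw _) (hw _)

lemma sum_pairWeight_mul (w : Ω → ℝ) (F : Ω → Ω → ℝ) :
    ∑ z : Bool → Ω, pairWeight w z * F (z false) (z true) =
      ∑ x, ∑ x', w x * w x' * F x x' := by
  rw [← (Equiv.boolArrowEquivProd Ω).symm.sum_comp, Fintype.sum_prod_type]
  rfl

lemma sum_pairWeight {w : Ω → ℝ} (hw1 : ∑ z, w z = 1) : ∑ z, pairWeight w z = 1 := by
  have := sum_pairWeight_mul w fun _ _ => 1
  simp only [mul_one] at this
  rw [this]
  simp [← Finset.mul_sum, hw1]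

lemma prod_cube_succ (F : (Fin (d + 1) → Bool) → ℝ) :
    ∏ e, F e = (∏ e : Fin d → Bool, F (Fin.cons false e)) * ∏ e, F (Fin.cons true e) := by
  rw [← (Fin.consEquiv fun _ => Bool).prod_comp, Fintype.prod_prod_type, Fintype.prod_bool,
    mul_comm]
  rfl

lemma cons_apply_cons (z : Bool → Ω) (y : Fin d → Bool → Ω) (b : Bool) (e : Fin d → Bool) :
    (fun i => (Fin.cons z y : Fin (d + 1) → Bool → Ω) i ((Fin.cons b e : Fin (d + 1) → Bool) i)) =
      (Fin.cons (z b) fun i => y i (e i) : Fin (d + 1) → Ω) := by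
  funext i
  refine Fin.cases ?_ (fun j => ?_) i <;> simp

lemma boxPow_zero (w : Ω → ℝ) (f : (Fin 0 → Ω) → ℝ) : boxPow w f = f Fin.elim0 := by
  rw [boxPow, avg_zero]
  rw [Fintype.prod_unique]
  congr 1
  exact Subsingleton.elim _ _

lemma boxPow_succ (w : Ω → ℝ) (f : (Fin (d + 1) → Ω) → ℝ) : boxPow w f = boxPair w f f := by
  rw [boxPow, avg_succ, boxPair, ← sum_pairWeight_mul w fun x x' =>
    boxPow w fun y => f (Fin.cons x y) * f (Fin.cons x' y)]
  refine Finset.sum_congr rfl fun z _ => ?_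
  rw [boxPow]
  congr 2
  funext y
  rw [prod_cube_succ, ← Finset.prod_mul_distrib]
  simp only [cons_apply_cons]

/-- The average of the product of the corners of a random section of `f`. -/
def sectionCorners (w : Ω → ℝ) (f : (Fin (d + 1) → Ω) → ℝ) (y : Fin d → Bool → Ω) : ℝ :=
  ∑ x, w x * ∏ e : Fin d → Bool, f (Fin.cons x fun i => y i (e i))

/-- With the corners `y` fixed, the averages over `x` and `x'` are independent and factor. The
pairing is thus an inner product, whence positivity and Cauchy–Schwarz. -/
lemma boxPair_eq_avg (w : Ω → ℝ) (f g : (Fin (d + 1) → Ω) → ℝ) :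
    boxPair w f g =
      avg (pairWeight w) fun y => sectionCorners w f y * sectionCorners w g y := by
  unfold boxPair boxPow
  simp only [← avg_const_mul, ← avg_sum]
  congr 1
  funext y
  rw [sectionCorners, sectionCorners, Finset.sum_mul_sum]
  refine Finset.sum_congr rfl fun x _ => Finset.sum_congr rfl fun x' _ => ?_
  rw [Finset.prod_mul_distrib]
  ring

/-- Dimension `0` is excluded: there `boxPow` is the value of `f`, of either sign. -/
lemma boxPow_succ_nonneg {w : Ω → ℝ} (hw : ∀ z, 0 ≤ w z) (f : (Fin (d + 1) → Ω) → ℝ) :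
    0 ≤ boxPow w f := by
  rw [boxPow_succ, boxPair_eq_avg]
  exact avg_nonneg (pairWeight_nonneg hw) fun y => mul_self_nonneg _

lemma boxPair_sq_le {w : Ω → ℝ} (hw : ∀ z, 0 ≤ w z) (f g : (Fin (d + 1) → Ω) → ℝ) :
    boxPair w f g ^ 2 ≤ boxPow w f * boxPow w g := by
  simp only [boxPow_succ, boxPair_eq_avg, ← sq]
  exact avg_mul_sq_le (pairWeight_nonneg hw) _ _

lemma boxPair_le_sqrt {w : Ω → ℝ} (hw : ∀ z, 0 ≤ w z) (f g : (Fin (d + 1) → Ω) → ℝ) :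
    boxPair w f g ≤ √(boxPow w f) * √(boxPow w g) := by
  rw [← Real.sqrt_mul (boxPow_succ_nonneg hw f)]
  exact Real.le_sqrt_of_sq_le (boxPair_sq_le hw f g)

lemma boxPow_const_mul (w : Ω → ℝ) (c : ℝ) (f : (Fin d → Ω) → ℝ) :
    boxPow w (fun x => c * f x) = c ^ 2 ^ d * boxPow w f := by
  unfold boxPow
  rw [← avg_const_mul]
  congr 1
  funext y
  rw [Finset.prod_mul_distrib]
  simp

lemma boxPow_neg (w : Ω → ℝ) (f : (Fin (d + 1) → Ω) → ℝ) :
    boxPow w (fun x => -f x) = boxPow w f := by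
  have := boxPow_const_mul w (-1) f
  rw [Even.neg_one_pow (by simp [Nat.even_pow]), one_mul] at this
  simpa using this

lemma boxPow_const {w : Ω → ℝ} (hw1 : ∑ z, w z = 1) (c : ℝ) :
    boxPow w (fun _ : Fin d → Ω => c) = c ^ 2 ^ d := by
  unfold boxPow
  rw [avg_const (sum_pairWeight hw1)]
  simp

lemma boxPow_congr {w : Ω → ℝ} {f g : (Fin d → Ω) → ℝ}
    (h : ∀ x, (∀ i, w (x i) ≠ 0) → f x = g x) : boxPow w f = boxPow w g := by
  refine avg_congr fun y hy => Finset.prod_congr rfl fun e _ => h _ fun i => ?_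
  have := hy i
  unfold pairWeight at this
  cases e i
  · exact left_ne_zero_of_mul this
  · exact right_ne_zero_of_mul this

lemma boxPow_le_one {w : Ω → ℝ} (hw : ∀ z, 0 ≤ w z) (hw1 : ∑ z, w z = 1)
    {f : (Fin d → Ω) → ℝ} (hf : ∀ x, |f x| ≤ 1) : boxPow w f ≤ 1 := by
  refine (avg_mono (pairWeight_nonneg hw) (G := fun _ => 1) fun y => ?_).trans_eq
    (avg_const (sum_pairWeight hw1) 1)
  refine (le_abs_self _).trans ?_
  rw [Finset.abs_prod]
  exact Finset.prod_le_one (fun e _ => abs_nonneg _) fun e _ => hf _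

/-- Cauchy–Schwarz for `boxPair` against the constant function `1`. -/
lemma sum_mul_boxPow_sq_le {w : Ω → ℝ} (hw : ∀ z, 0 ≤ w z) (hw1 : ∑ z, w z = 1)
    (f : (Fin (d + 1) → Ω) → ℝ) :
    (∑ x, w x * boxPow w fun y => f (Fin.cons x y)) ^ 2 ≤ boxPow w f := by
  have := boxPair_sq_le hw f fun _ => 1
  rw [boxPow_const hw1, one_pow, mul_one] at this
  convert this using 2
  unfold boxPair
  refine Finset.sum_congr rfl fun x _ => ?_
  simp only [mul_one]
  rw [← Finset.sum_mul, ← Finset.mul_sum, hw1, mul_one]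

lemma sum_mul_avg_mul (w : Ω → ℝ) (f : (Fin (d + 1) → Ω) → ℝ) :
    ∑ x, ∑ x', w x * w x' * avg w (fun y => f (Fin.cons x y) * f (Fin.cons x' y)) =
      avg w fun y => (∑ x, w x * f (Fin.cons x y)) ^ 2 := by
  simp only [← avg_const_mul, ← avg_sum]
  congr 1
  funext y
  rw [sq, Finset.sum_mul_sum]
  exact Finset.sum_congr rfl fun x _ => Finset.sum_congr rfl fun x' _ => by ring

lemma avg_succ' (w : Ω → ℝ) (f : (Fin (d + 1) → Ω) → ℝ) :
    avg w f = avg w fun y => ∑ x, w x * f (Fin.cons x y) := by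
  rw [avg_succ]
  simp only [← avg_const_mul, ← avg_sum]

lemma avg_sq_le_sum {w : Ω → ℝ} (hw : ∀ z, 0 ≤ w z) (hw1 : ∑ z, w z = 1)
    (f : (Fin (d + 1) → Ω) → ℝ) :
    avg w f ^ 2 ≤
      ∑ x, ∑ x', w x * w x' * avg w (fun y => f (Fin.cons x y) * f (Fin.cons x' y)) := by
  rw [sum_mul_avg_mul, avg_succ']
  exact avg_pow_le hw hw1 _ even_two

/-- The mean is dominated by the box norm. -/
lemma avg_pow_le_boxPow {w : Ω → ℝ} (hw : ∀ z, 0 ≤ w z) (hw1 : ∑ z, w z = 1)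
    (f : (Fin d → Ω) → ℝ) : avg w f ^ 2 ^ d ≤ boxPow w f := by
  induction d with
  | zero => simp [avg_zero, boxPow_zero]
  | succ d ih =>
    rw [pow_succ' 2 d, pow_mul, boxPow_succ]
    set A : Ω → Ω → ℝ := fun x x' => avg w fun y => f (Fin.cons x y) * f (Fin.cons x' y) with hA
    have h1 : avg w f ^ 2 ≤ ∑ x, ∑ x', w x * w x' * A x x' := avg_sq_le_sum hw hw1 f
    have h2 : (∑ x, ∑ x', w x * w x' * A x x') ^ 2 ^ d ≤
        ∑ x, ∑ x', w x * w x' * A x x' ^ 2 ^ d := by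
      -- The exponent `2 ^ d` is even only for `d > 0`; for `d = 0` both sides agree.
      rcases Nat.eq_zero_or_pos d with rfl | hd
      · simp
      · have := Real.pow_arith_mean_le_arith_mean_pow_of_even Finset.univ
          (pairWeight w) (fun z => A (z false) (z true)) (fun z _ => pairWeight_nonneg hw z)
          (sum_pairWeight hw1) (n := 2 ^ d) (by simp [Nat.even_pow, hd.ne'])
        rwa [sum_pairWeight_mul, sum_pairWeight_mul w fun x x' => A x x' ^ 2 ^ d] at this
    refine (pow_le_pow_left₀ (sq_nonneg _) h1 _).trans (h2.trans ?_)
    exact Finset.sum_le_sum fun x _ => Finset.sum_le_sum fun x' _ =>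
      mul_le_mul_of_nonneg_left (ih _) (mul_nonneg (hw _) (hw _))

/-- A weighted form of the triangle inequality for the box norm. -/
lemma boxPow_sum_le {w : Ω → ℝ} (hw : ∀ z, 0 ≤ w z) {ι : Type*} (S : Finset ι) (c : ι → ℝ)
    (hc : ∀ a, 0 < c a) (f : ι → (Fin d → Ω) → ℝ) :
    boxPow w (fun x => ∑ a ∈ S, f a x) ≤
      (∑ a ∈ S, c a) ^ (2 ^ d - 1) * ∑ a ∈ S, boxPow w (f a) / c a ^ (2 ^ d - 1) := by
  -- The free weights `c` replace the norms of the `f a`: bounding each norm by `c a` yields the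
  -- triangle inequality without roots.
  induction d generalizing ι with
  | zero => simp [boxPow_zero]
  | succ d ih =>
    obtain ⟨M, hM⟩ : ∃ M, 2 ^ d = M + 1 := ⟨2 ^ d - 1, by have := Nat.one_le_two_pow (n := d); omega⟩
    have hM' : 2 ^ (d + 1) - 1 = 2 * M + 1 := by rw [pow_succ, hM]; omega
    rw [hM']
    simp only [hM, Nat.add_sub_cancel] at ih
    set C := ∑ a ∈ S, c a with hC
    have hC0 : 0 ≤ C := Finset.sum_nonneg fun a _ => (hc a).le
    have hCC : ∑ p ∈ S ×ˢ S, c p.1 * c p.2 = C ^ 2 := by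
      rw [Finset.sum_product, sq, Finset.sum_mul_sum]
    -- For fixed `x, x'` the product expands over pairs; the induction hypothesis applies with
    -- weights `c a * c b`, of total `C ^ 2`.
    have step : ∀ x x', boxPow w (fun y => (∑ a ∈ S, f a (Fin.cons x y)) *
        ∑ a ∈ S, f a (Fin.cons x' y)) ≤ (C ^ 2) ^ M * ∑ p ∈ S ×ˢ S,
          boxPow w (fun y => f p.1 (Fin.cons x y) * f p.2 (Fin.cons x' y)) /
            (c p.1 * c p.2) ^ M := by
      intro x x'
      have := ih (S ×ˢ S) (fun p => c p.1 * c p.2) (fun p => mul_pos (hc _) (hc _))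
        fun p y => f p.1 (Fin.cons x y) * f p.2 (Fin.cons x' y)
      rw [hCC] at this
      refine le_trans (le_of_eq ?_) this
      congr 1
      funext y
      rw [Finset.sum_mul_sum, Finset.sum_product]
    have h1 : boxPow w (fun x => ∑ a ∈ S, f a x) ≤ (C ^ 2) ^ M * ∑ p ∈ S ×ˢ S,
        boxPair w (f p.1) (f p.2) / (c p.1 * c p.2) ^ M := by
      rw [boxPow_succ]
      refine (Finset.sum_le_sum fun x _ => Finset.sum_le_sum fun x' _ =>
        mul_le_mul_of_nonneg_left (step x x') (mul_nonneg (hw _) (hw _))).trans_eq ?_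
      unfold boxPair
      simp only [Finset.sum_div, Finset.mul_sum]
      rw [Finset.sum_comm (s := S ×ˢ S)]
      refine Finset.sum_congr rfl fun x _ => ?_
      rw [Finset.sum_comm (s := S ×ˢ S)]
      refine Finset.sum_congr rfl fun x' _ => Finset.sum_congr rfl fun p _ => ?_
      ring
    -- Cauchy–Schwarz for `boxPair` separates `a` from `b`, so the double sum is at most a square.
    have h2 : ∑ p ∈ S ×ˢ S, boxPair w (f p.1) (f p.2) / (c p.1 * c p.2) ^ M ≤
        (∑ a ∈ S, √(boxPow w (f a)) / c a ^ M) ^ 2 := by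
      rw [sq, Finset.sum_mul_sum, Finset.sum_product]
      refine Finset.sum_le_sum fun a _ => Finset.sum_le_sum fun b _ => ?_
      rw [div_mul_div_comm, ← mul_pow]
      exact div_le_div_of_nonneg_right (boxPair_le_sqrt hw _ _)
        (pow_nonneg (mul_pos (hc _) (hc _)).le _)
    have h3 : (∑ a ∈ S, √(boxPow w (f a)) / c a ^ M) ^ 2 ≤
        C * ∑ a ∈ S, boxPow w (f a) / c a ^ (2 * M + 1) := by
      refine Finset.sum_sq_le_sum_mul_sum_of_sq_le_mul _ (fun a _ => (hc a).le)
        (fun a _ => div_nonneg (boxPow_succ_nonneg hw _) (pow_nonneg (hc a).le _))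
        fun a _ => le_of_eq ?_
      rw [div_pow, Real.sq_sqrt (boxPow_succ_nonneg hw _)]
      have := (hc a).ne'
      field_simp
      ring
    calc _ ≤ _ := h1
      _ ≤ (C ^ 2) ^ M * (C * ∑ a ∈ S, boxPow w (f a) / c a ^ (2 * M + 1)) :=
        mul_le_mul_of_nonneg_left (h2.trans h3) (by positivity)
      _ = _ := by ring

/-- The triangle inequality for the box norm. -/
lemma boxPow_sum_le_of_le {w : Ω → ℝ} (hw : ∀ z, 0 ≤ w z) {ι : Type*} (S : Finset ι) (c : ι → ℝ)
    (hc : ∀ a, 0 < c a) (f : ι → (Fin d → Ω) → ℝ)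
    (hf : ∀ a ∈ S, boxPow w (f a) ≤ c a ^ 2 ^ d) :
    boxPow w (fun x => ∑ a ∈ S, f a x) ≤ (∑ a ∈ S, c a) ^ 2 ^ d := by
  obtain ⟨M, hM⟩ : ∃ M, 2 ^ d = M + 1 := ⟨2 ^ d - 1, by have := Nat.one_le_two_pow (n := d); omega⟩
  refine (boxPow_sum_le hw S c hc f).trans ?_
  have hC0 : 0 ≤ ∑ a ∈ S, c a := Finset.sum_nonneg fun a _ => (hc a).le
  rw [hM] at hf ⊢
  rw [Nat.add_sub_cancel, pow_succ]
  refine mul_le_mul_of_nonneg_left (Finset.sum_le_sum fun a ha => ?_) (pow_nonneg hC0 _)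
  rw [div_le_iff₀ (pow_pos (hc a) _), ← pow_succ']
  exact hf a ha

lemma boxPow_add_le {w : Ω → ℝ} (hw : ∀ z, 0 ≤ w z) {f g : (Fin d → Ω) → ℝ} {a b : ℝ}
    (ha : 0 ≤ a) (hb : 0 ≤ b) (hf : boxPow w f ≤ a ^ 2 ^ d) (hg : boxPow w g ≤ b ^ 2 ^ d) :
    boxPow w (fun x => f x + g x) ≤ (a + b) ^ 2 ^ d := by
  -- The weights must be positive, but `a` and `b` may vanish: enlarge both by `t` and let `t → 0`.
  have key : ∀ t : ℝ, 0 < t → boxPow w (fun x => f x + g x) ≤ ((a + t) + (b + t)) ^ 2 ^ d := by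
    intro t ht
    have := boxPow_sum_le_of_le hw Finset.univ (fun i : Bool => if i then a + t else b + t)
      (by intro i; cases i <;> simp <;> linarith) (fun i => if i then f else g) (by
        intro i _
        cases i
        · simpa using hg.trans (pow_le_pow_left₀ hb (by linarith) _)
        · simpa using hf.trans (pow_le_pow_left₀ ha (by linarith) _))
    simpa using this
  have hlim : Filter.Tendsto (fun t : ℝ => ((a + t) + (b + t)) ^ 2 ^ d)
      (nhdsWithin 0 (Set.Ioi 0)) (nhds ((a + b) ^ 2 ^ d)) := by
    have : Continuous fun t : ℝ => ((a + t) + (b + t)) ^ 2 ^ d := by fun_prop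
    have h := this.tendsto 0
    simp only [add_zero] at h
    exact h.mono_left nhdsWithin_le_nhds
  exact ge_of_tendsto hlim (by filter_upwards [self_mem_nhdsWithin] with t ht using key t ht)

end Basic

/-! ### Near-minimal box powers force closeness to a constant. -/

section Family

universe u v

variable {Ω : Type v} [Fintype Ω] {d : ℕ}

lemma boxPow_one (w : Ω → ℝ) (f : (Fin 1 → Ω) → ℝ) : boxPow w f = avg w f ^ 2 := by
  rw [boxPow_succ, boxPair, avg_succ]
  simp only [boxPow_zero, avg_zero]
  rw [sq, Finset.sum_mul_sum]
  exact Finset.sum_congr rfl fun x _ => Finset.sum_congr rfl fun x' _ => by ring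

/-- Unit weights lose `3 ^ (2 ^ d - 1)` but keep the bound linear in `boxPow`, so that it can be
averaged over sections. -/
lemma boxPow_three_le {w : Ω → ℝ} (hw : ∀ z, 0 ≤ w z) (f g h : (Fin d → Ω) → ℝ) :
    boxPow w (fun x => f x + g x + h x) ≤
      3 ^ (2 ^ d - 1) * (boxPow w f + boxPow w g + boxPow w h) := by
  have := boxPow_sum_le hw Finset.univ (fun _ : Fin 3 => 1) (fun _ => one_pos) ![f, g, h]
  simpa [Fin.sum_univ_three] using this

lemma sum_sum_mul_left {w : Ω → ℝ} (hw1 : ∑ z, w z = 1) (F : Ω → ℝ) :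
    ∑ x, ∑ x', w x * w x' * F x = ∑ x, w x * F x := by
  refine Finset.sum_congr rfl fun x _ => ?_
  rw [← Finset.sum_mul, ← Finset.mul_sum, hw1, mul_one]

lemma sum_sum_mul_right {w : Ω → ℝ} (hw1 : ∑ z, w z = 1) (F : Ω → ℝ) :
    ∑ x, ∑ x', w x * w x' * F x' = ∑ x, w x * F x := by
  rw [Finset.sum_comm, ← sum_sum_mul_left hw1]
  exact Finset.sum_congr rfl fun x _ => Finset.sum_congr rfl fun x' _ => by ring

/-- Centering in one coordinate. -/
lemma boxPow_sub_const_le {w : Ω → ℝ} (hw : ∀ z, 0 ≤ w z) (hw1 : ∑ z, w z = 1)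
    (f : (Fin (d + 2) → Ω) → ℝ) {p : ℝ} (hp0 : 0 ≤ p) (hp1 : p ≤ 1) :
    boxPow w (fun y => f y - p) ≤ 3 ^ (2 ^ (d + 1) - 1) *
      (∑ x, ∑ x', w x * w x' *
          boxPow w (fun y => f (Fin.cons x y) * f (Fin.cons x' y) - p ^ 2) +
        2 * ∑ x, w x * boxPow w fun y => f (Fin.cons x y) - p) := by
  have key : ∀ x x', boxPow w (fun y => (f (Fin.cons x y) - p) * (f (Fin.cons x' y) - p)) ≤
      3 ^ (2 ^ (d + 1) - 1) *
        (boxPow w (fun y => f (Fin.cons x y) * f (Fin.cons x' y) - p ^ 2) +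
          boxPow w (fun y => f (Fin.cons x y) - p) + boxPow w fun y => f (Fin.cons x' y) - p) := by
    intro x x'
    have hpn : ∀ g : (Fin (d + 1) → Ω) → ℝ, boxPow w (fun y => -p * g y) ≤ boxPow w g := by
      intro g
      rw [boxPow_const_mul]
      refine mul_le_of_le_one_left (boxPow_succ_nonneg hw g) ?_
      rw [Even.neg_pow (by simp [Nat.even_pow])]
      exact pow_le_one₀ hp0 hp1
    -- This is `(u-p)(v-p) = (uv-p^2) - p(u-p) - p(v-p)` for the two sections `u, v`.
    have h := boxPow_three_le hw (fun y => f (Fin.cons x y) * f (Fin.cons x' y) - p ^ 2)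
      (fun y => -p * (f (Fin.cons x y) - p)) fun y => -p * (f (Fin.cons x' y) - p)
    refine le_trans (le_of_eq ?_) (h.trans ?_)
    · congr 1
      funext y
      ring
    · gcongr
      · exact hpn _
      · exact hpn _
  rw [boxPow_succ]
  refine (Finset.sum_le_sum fun x _ => Finset.sum_le_sum fun x' _ =>
    mul_le_mul_of_nonneg_left (key x x') (mul_nonneg (hw _) (hw _))).trans_eq ?_
  have h1 := sum_sum_mul_left hw1 fun x => boxPow w fun y => f (Fin.cons x y) - p
  have h2 := sum_sum_mul_right hw1 fun x => boxPow w fun y => f (Fin.cons x y) - p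
  rw [two_mul]
  nth_rw 1 [← h1]
  rw [← h2]
  simp only [mul_add, Finset.mul_sum, Finset.sum_add_distrib]
  simp only [mul_left_comm, mul_assoc]
  ring

/-- A family of functions whose mean is at least about `p` and whose box norms are on average
at most about `p` is on average close to `p` in the box norm. -/
theorem sum_boxPow_sub_le (k : ℕ) {ι : Type (max u v)} [Fintype ι] (lam : ι → ℝ)
    (hlam : ∀ i, 0 ≤ lam i) (hlam1 : ∑ i, lam i = 1) (w : ι → Ω → ℝ) (hw : ∀ i z, 0 ≤ w i z)
    (hw1 : ∀ i, ∑ z, w i z = 1) (f : ι → (Fin (k + 1) → Ω) → ℝ) (hf0 : ∀ i x, 0 ≤ f i x)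
    (hf1 : ∀ i x, f i x ≤ 1) {p τ : ℝ} (hp0 : 0 ≤ p) (hp1 : p ≤ 1) (hτ : 0 ≤ τ)
    (hmean : p - τ ^ 2 ^ k ≤ ∑ i, lam i * avg (w i) (f i))
    (hbox : ∑ i, lam i * boxPow (w i) (f i) ≤ p ^ 2 ^ (k + 1) + τ ^ 2 ^ k) :
    ∑ i, lam i * boxPow (w i) (fun x => f i x - p) ≤ 2 ^ k * 3 ^ (2 ^ (k + 1) - 1) * τ := by
  -- The family must vary, because the section variables in `Ω` are absorbed into `ι`; `Type (max u
  -- v)` is closed under this. The error is `τ ^ 2 ^ k` because passing to sections costs a square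
  -- root each time.
  induction k generalizing ι p τ with
  | zero =>
    simp only [zero_add, pow_zero, pow_one, one_mul, boxPow_one] at hmean hbox ⊢
    -- In dimension one this is a variance computation, with error `τ + 2pτ ≤ 3τ`.
    have : ∀ i, lam i * avg (w i) (fun x => f i x - p) ^ 2 =
        lam i * avg (w i) (f i) ^ 2 - 2 * p * (lam i * avg (w i) (f i)) + p ^ 2 * lam i := by
      intro i
      rw [avg_sub, avg_const (hw1 i)]
      ring
    simp only [this, Finset.sum_add_distrib, Finset.sum_sub_distrib, ← Finset.mul_sum, hlam1]
    norm_num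
    nlinarith
  | succ k ih =>
    set A : ℝ := 2 ^ k * 3 ^ (2 ^ (k + 1) - 1) with hA
    have hA1 : 1 ≤ A := one_le_mul_of_one_le_of_one_le (one_le_pow₀ (by norm_num))
      (one_le_pow₀ (by norm_num))
    -- The recurrence for the constant: three terms, each bounded by `A * (2τ)`, times the loss from
    -- centering.
    have hconst : (2 : ℝ) ^ (k + 1) * 3 ^ (2 ^ (k + 1 + 1) - 1) =
        3 ^ (2 ^ (k + 1) - 1) * (3 * (A * 2)) := by
      obtain ⟨M, hM⟩ : ∃ M, 2 ^ (k + 1) = M + 1 :=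
        ⟨2 ^ (k + 1) - 1, by have := Nat.one_le_two_pow (n := k + 1); omega⟩
      have : 2 ^ (k + 1 + 1) - 1 = M + M + 1 := by rw [pow_succ, hM]; omega
      rw [this, hA, hM, Nat.add_sub_cancel]
      ring
    rw [hconst]
    by_cases hτ1 : 1 ≤ τ
    · calc ∑ i, lam i * boxPow (w i) (fun x => f i x - p)
          ≤ ∑ i, lam i * 1 := Finset.sum_le_sum fun i _ => mul_le_mul_of_nonneg_left
            (boxPow_le_one (hw i) (hw1 i) fun x => by
              rw [abs_le]; constructor <;> linarith [hf0 i x, hf1 i x]) (hlam i)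
        _ = 1 := by simpa using hlam1
        _ ≤ _ := by
          have h3 : (1 : ℝ) ≤ 3 ^ (2 ^ (k + 1) - 1) := one_le_pow₀ (by norm_num)
          have : 1 ≤ A * τ := one_le_mul_of_one_le_of_one_le hA1 hτ1
          nlinarith
    push Not at hτ1
    have hτk : τ ^ 2 ^ (k + 1) ≤ τ ^ 2 ^ k :=
      pow_le_pow_of_le_one hτ hτ1.le (Nat.pow_le_pow_right two_pos (Nat.le_succ k))
    have h2τ : 2 * τ ^ 2 ^ k ≤ (2 * τ) ^ 2 ^ k := by
      rw [mul_pow]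
      exact mul_le_mul_of_nonneg_right
        (le_self_pow₀ (by norm_num) (pow_pos two_pos k).ne') (pow_nonneg hτ _)
    have hτpos : 0 ≤ τ ^ 2 ^ k := pow_nonneg hτ _
    have hτpos' : 0 ≤ τ ^ 2 ^ (k + 1) := pow_nonneg hτ _
    -- products of sections
    have hI := ih (ι := ι × Ω × Ω) (fun q => lam q.1 * (w q.1 q.2.1 * w q.1 q.2.2))
      (fun q => mul_nonneg (hlam _) (mul_nonneg (hw _ _) (hw _ _)))
      (by simp only [Fintype.sum_prod_type, ← Finset.mul_sum, hw1, mul_one, hlam1])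
      (fun q => w q.1) (fun q => hw q.1) (fun q => hw1 q.1)
      (fun q y => f q.1 (Fin.cons q.2.1 y) * f q.1 (Fin.cons q.2.2 y))
      (fun q y => mul_nonneg (hf0 _ _) (hf0 _ _))
      (fun q y => mul_le_one₀ (hf1 _ _) (hf0 _ _) (hf1 _ _))
      (p := p ^ 2) (τ := 2 * τ) (sq_nonneg p) (pow_le_one₀ hp0 hp1) (by linarith)
      (by
        simp only [Fintype.sum_prod_type, mul_assoc (lam _), ← Finset.mul_sum]
        have h1 : (∑ i, lam i * avg (w i) (f i)) ^ 2 ≤ ∑ i, lam i * avg (w i) (f i) ^ 2 :=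
          Real.pow_arith_mean_le_arith_mean_pow_of_even _ _ _ (fun i _ => hlam i) hlam1 even_two
        have h2 := h1.trans (Finset.sum_le_sum fun i _ =>
          mul_le_mul_of_nonneg_left (avg_sq_le_sum (hw i) (hw1 i) (f i)) (hlam i))
        refine le_trans ?_ h2
        set E := ∑ i, lam i * avg (w i) (f i)
        -- The lower bound on the mean can be squared only when it is nonnegative; otherwise `p ^ 2`
        -- is itself below the error.
        by_cases hpt : p ≤ τ ^ 2 ^ (k + 1)
        · nlinarith [sq_nonneg E]
        · push Not at hpt
          nlinarith [mul_self_le_mul_self (sub_nonneg.2 hpt.le) hmean])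
      (by
        simp only [Fintype.sum_prod_type, mul_assoc (lam _), ← Finset.mul_sum]
        -- The box powers of the products of two sections average exactly to that of `f`.
        have : ∑ i, lam i * ∑ x, ∑ x', w i x * w i x' *
            boxPow (w i) (fun y => f i (Fin.cons x y) * f i (Fin.cons x' y)) =
            ∑ i, lam i * boxPow (w i) (f i) :=
          Finset.sum_congr rfl fun i _ => by rw [boxPow_succ]; rfl
        rw [this, ← pow_mul, ← pow_succ' 2 (k + 1)]
        linarith)
    -- sections
    have hII := ih (ι := ι × Ω) (fun q => lam q.1 * w q.1 q.2)
      (fun q => mul_nonneg (hlam _) (hw _ _))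
      (by simp only [Fintype.sum_prod_type, ← Finset.mul_sum, hw1, mul_one, hlam1])
      (fun q => w q.1) (fun q => hw q.1) (fun q => hw1 q.1)
      (fun q y => f q.1 (Fin.cons q.2 y)) (fun q y => hf0 _ _) (fun q y => hf1 _ _)
      (p := p) (τ := 2 * τ) hp0 hp1 (by linarith)
      (by
        simp only [Fintype.sum_prod_type, mul_assoc (lam _), ← Finset.mul_sum, ← avg_succ]
        linarith)
      (by
        simp only [Fintype.sum_prod_type, mul_assoc (lam _), ← Finset.mul_sum]
        set B : ι → ℝ := fun i => ∑ x, w i x * boxPow (w i) fun y => f i (Fin.cons x y) with hB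
        have h1 : (∑ i, lam i * B i) ^ 2 ≤ ∑ i, lam i * B i ^ 2 :=
          Real.pow_arith_mean_le_arith_mean_pow_of_even _ _ _ (fun i _ => hlam i) hlam1 even_two
        have h2 := (h1.trans (Finset.sum_le_sum fun i _ => mul_le_mul_of_nonneg_left
          (sum_mul_boxPow_sq_le (hw i) (hw1 i) (f i)) (hlam i))).trans hbox
        -- Taking the root here halves the exponent of `τ`.
        have h3 : (∑ i, lam i * B i) ^ 2 ≤ (p ^ 2 ^ (k + 1) + τ ^ 2 ^ k) ^ 2 := by
          refine h2.trans ?_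
          rw [pow_succ 2 (k + 1), pow_mul p, pow_succ 2 k, pow_mul τ]
          nlinarith [mul_nonneg (pow_nonneg hp0 (2 ^ k * 2)) hτpos]
        have h4 := abs_le_of_sq_le_sq h3 (add_nonneg (pow_nonneg hp0 _) hτpos)
        exact ((le_abs_self _).trans h4).trans (by linarith))
    simp only [Fintype.sum_prod_type, mul_assoc (lam _), ← Finset.mul_sum] at hI hII
    calc ∑ i, lam i * boxPow (w i) (fun x => f i x - p)
        ≤ ∑ i, lam i * (3 ^ (2 ^ (k + 1) - 1) *
            (∑ x, ∑ x', w i x * w i x' * boxPow (w i)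
              (fun y => f i (Fin.cons x y) * f i (Fin.cons x' y) - p ^ 2) +
            2 * ∑ x, w i x * boxPow (w i) fun y => f i (Fin.cons x y) - p)) :=
          Finset.sum_le_sum fun i _ => mul_le_mul_of_nonneg_left
            (boxPow_sub_const_le (hw i) (hw1 i) (f i) hp0 hp1) (hlam i)
      _ = 3 ^ (2 ^ (k + 1) - 1) * (∑ i, lam i * (∑ x, ∑ x', w i x * w i x' * boxPow (w i)
              (fun y => f i (Fin.cons x y) * f i (Fin.cons x' y) - p ^ 2)) +
            2 * ∑ i, lam i * ∑ x, w i x * boxPow (w i) fun y => f i (Fin.cons x y) - p) := by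
          rw [mul_add, Finset.mul_sum, Finset.mul_sum, Finset.mul_sum,
            ← Finset.sum_add_distrib]
          exact Finset.sum_congr rfl fun i _ => by ring
      _ ≤ 3 ^ (2 ^ (k + 1) - 1) * (A * (2 * τ) + 2 * (A * (2 * τ))) := by gcongr
      _ = _ := by ring

end Family

/-! ### From measures on a finite space to weighted sums. -/

/-- The point masses of a measure. -/
def wt {Ω : Type*} [MeasurableSpace Ω] (μ : Measure Ω) (x : Ω) : ℝ := μ.real {x}

section Weights

variable {Ω : Type*} [Fintype Ω] [MeasurableSpace Ω] [MeasurableSingletonClass Ω]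
  (μ : Measure Ω) [IsProbabilityMeasure μ] {d : ℕ}

lemma wt_nonneg (x : Ω) : 0 ≤ wt μ x := measureReal_nonneg

lemma sum_wt : ∑ x, wt μ x = 1 := by
  simp [wt]

lemma integral_pi_eq_sum {κ : Type*} [Fintype κ] [DecidableEq κ] (F : (κ → Ω) → ℝ) :
    ∫ x, F x ∂(Measure.pi fun _ : κ => μ) = ∑ y, (∏ i, wt μ (y i)) * F y := by
  rw [integral_fintype (Integrable.of_finite)]
  refine Finset.sum_congr rfl fun y _ => ?_
  simp [wt, measureReal_def, Measure.pi_singleton, ENNReal.toReal_prod]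

lemma mean_eq_avg (f : (Fin d → Ω) → ℝ) : mean μ f = avg (wt μ) f := integral_pi_eq_sum μ f

lemma integral_cube_eq_boxPow (f : (Fin d → Ω) → ℝ) :
    ∫ ω : Fin d × Bool → Ω, ∏ e : Fin d → Bool, f (fun i => ω (i, e i))
      ∂(Measure.pi fun _ : Fin d × Bool => μ) = boxPow (wt μ) f := by
  rw [integral_pi_eq_sum, boxPow, avg, ← (Equiv.curry (Fin d) Bool Ω).sum_comp]
  refine Finset.sum_congr rfl fun y _ => ?_
  rw [Fintype.prod_prod_type]
  simp only [Fintype.prod_bool, mul_comm (wt μ (y (_, true)))]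
  rfl

lemma boxNorm_eq (f : (Fin d → Ω) → ℝ) :
    boxNorm μ f = boxPow (wt μ) f ^ ((1 : ℝ) / 2 ^ d) := by
  rw [boxNorm, integral_cube_eq_boxPow]

/-- Turns almost sure identities into pointwise ones on the points of nonzero weight, the only ones
that `avg` and `boxPow` see. -/
lemma ae_pi_iff {κ : Type*} [Fintype κ] {p : (κ → Ω) → Prop} :
    (∀ᵐ x ∂(Measure.pi fun _ : κ => μ), p x) ↔ ∀ x, (∀ i, wt μ (x i) ≠ 0) → p x := by
  rw [ae_iff_of_countable]
  refine forall_congr' fun x => ?_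
  rw [Measure.pi_singleton, Finset.prod_ne_zero_iff]
  simp [wt, measureReal_eq_zero_iff]

lemma boxNorm_le_iff {d : ℕ} (f : (Fin (d + 1) → Ω) → ℝ) {r : ℝ} (hr : 0 ≤ r) :
    boxNorm μ f ≤ r ↔ boxPow (wt μ) f ≤ r ^ 2 ^ (d + 1) := by
  have h0 := boxPow_succ_nonneg (wt_nonneg μ) f
  have hpos : (0 : ℝ) < 2 ^ (d + 1) := by positivity
  rw [boxNorm_eq, one_div, Real.rpow_inv_le_iff_of_pos h0 hr hpos]
  rw [← Real.rpow_natCast r]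
  norm_num

end Weights

/-! ### Finite marginals of the infinite product measure. -/

section Marginals

variable {I Ω : Type*} [MeasurableSpace Ω] (μ : Measure Ω) [IsProbabilityMeasure μ]

lemma measurePreserving_precomp {κ : Type*} [Fintype κ] {q : κ → I}
    (hq : Function.Injective q) :
    MeasurePreserving (fun (ω : I → Ω) k => ω (q k)) (Measure.infinitePi fun _ : I => μ)
      (Measure.pi fun _ : κ => μ) := by
  have hmeas : Measurable fun (ω : I → Ω) k => ω (q k) :=
    measurable_pi_lambda _ fun k => measurable_pi_apply _
  refine ⟨hmeas, ?_⟩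
  have h1 : ProbabilityTheory.iIndepFun (fun (i : I) (ω : I → Ω) => ω i)
      (Measure.infinitePi fun _ : I => μ) :=
    ProbabilityTheory.iIndepFun_infinitePi (P := fun _ : I => μ) (X := fun _ x => x)
      fun _ => measurable_id
  have h2 := h1.precomp hq
  rw [ProbabilityTheory.iIndepFun_iff_map_fun_eq_pi_map
    fun k => (measurable_pi_apply (q k)).aemeasurable] at h2
  rw [h2]
  congr 1
  funext k
  exact (measurePreserving_eval_infinitePi (fun _ : I => μ) (q k)).map_eq

lemma integral_precomp [Finite Ω] [MeasurableSingletonClass Ω] {κ : Type*} [Fintype κ] {q : κ → I}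
    (hq : Function.Injective q) (F : (κ → Ω) → ℝ) :
    ∫ ω : I → Ω, F (fun k => ω (q k)) ∂(Measure.infinitePi fun _ : I => μ) =
      ∫ x, F x ∂(Measure.pi fun _ : κ => μ) := by
  have h := measurePreserving_precomp μ hq
  rw [← h.map_eq, integral_map h.measurable.aemeasurable]
  exact (measurable_of_countable F).aestronglyMeasurable

end Marginals

/-! ### Constant-value events under the array and the mixture. -/

section Laws

variable {𝒳 : Type*} [Fintype 𝒳] [MeasurableSpace 𝒳] [MeasurableSingletonClass 𝒳]

lemma abs_sub_le_tvDist {E : Type*} [MeasurableSpace E] (P Q : Measure E) [IsFiniteMeasure P]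
    [IsFiniteMeasure Q] {A : Set E} (hA : MeasurableSet A) :
    |P.real A - Q.real A| ≤ tvDist P Q := by
  refine le_ciSup (f := fun A : {A : Set E // MeasurableSet A} => |P.real A.1 - Q.real A.1|)
    ⟨P.real Set.univ + Q.real Set.univ, ?_⟩ ⟨A, hA⟩
  rintro _ ⟨B, rfl⟩
  have h1 : P.real B.1 ≤ P.real Set.univ := measureReal_mono (Set.subset_univ _)
  have h2 : Q.real B.1 ≤ Q.real Set.univ := measureReal_mono (Set.subset_univ _)
  have h3 : 0 ≤ P.real B.1 := measureReal_nonneg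
  have h4 : 0 ≤ Q.real B.1 := measureReal_nonneg
  rw [abs_le]
  constructor <;> linarith

/-- The event that all variables indexed by `B` take the value `a`. -/
def constOn {I : Type*} {d : ℕ} (F B : Finset (DSubset I d)) (a : 𝒳) : Set (F → 𝒳) :=
  {b | ∀ s : F, s.1 ∈ B → b s = a}

lemma jointLaw_constOn {I Ω₀ : Type*} [MeasurableSpace Ω₀] {d : ℕ} (P : Measure Ω₀)
    {X : DSubset I d → Ω₀ → 𝒳} (hX : ∀ s, Measurable (X s)) {F B : Finset (DSubset I d)}
    (hBF : B ⊆ F) (a : 𝒳) :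
    (jointLaw P X F).real (constOn F B a) = P.real (⋂ s ∈ B, {ω | X s ω = a}) := by
  rw [jointLaw, map_measureReal_apply (measurable_pi_lambda (fun ω (s : F) => X s.1 ω) fun s => hX s.1)
    (Set.toFinite _).measurableSet]
  congr 1
  ext ω
  simp only [constOn, Set.mem_preimage, Set.mem_ofPred_eq, Set.mem_iInter]
  exact ⟨fun h s hs => h ⟨s, hBF hs⟩ hs, fun h s hs => h s.1 hs⟩

variable {I J Ω : Type*} [LinearOrder I] [Fintype J] [MeasurableSpace Ω] {d : ℕ}
  (lam : J → ℝ) (μ : J → Measure Ω) [∀ j, IsProbabilityMeasure (μ j)]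
  (h : J → 𝒳 → (Fin d → Ω) → ℝ)

lemma isFiniteMeasure_mixtureLaw (F : Finset (DSubset I d)) :
    IsFiniteMeasure (mixtureLaw lam μ h F) := by
  constructor
  rw [mixtureLaw, Measure.finsetSum_apply]
  refine ENNReal.sum_lt_top.2 fun a _ => ?_
  simp

variable {μ h}

/-- Summing the point masses of the event turns the product over `F` into a product of sums; a
factor outside `B` is `∑ c, h j c = 1` almost surely. -/
lemma mixtureLaw_constOn [Finite I] [Finite Ω] [MeasurableSingletonClass Ω]
    (hlam : ∀ j, 0 ≤ lam j) (hh : ∀ j, IsPartitionOfUnity (μ j) (h j))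
    {F B : Finset (DSubset I d)} (hBF : B ⊆ F) (a : 𝒳) :
    (mixtureLaw lam μ h F).real (constOn F B a) =
      ∑ j, lam j * ∫ ω : I → Ω, ∏ s ∈ B, h j a (coords ω s)
        ∂(Measure.infinitePi fun _ : I => μ j) := by
  classical
  have hint : ∀ b : F → 𝒳, 0 ≤ ∑ j, lam j * ∫ ω : I → Ω, ∏ s : F, h j (b s) (coords ω s.1)
      ∂(Measure.infinitePi fun _ : I => μ j) := fun b =>
    Finset.sum_nonneg fun j _ => mul_nonneg (hlam j) <|
      integral_nonneg fun ω => Finset.prod_nonneg fun s _ => ((hh j).mem_Icc _ _).1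
  set t : F → Finset 𝒳 := fun s => if s.1 ∈ B then {a} else Finset.univ with ht
  have hmem : ∀ b : F → 𝒳, b ∈ Fintype.piFinset t ↔ b ∈ constOn F B a := by
    intro b
    simp only [Fintype.mem_piFinset, ht, constOn, Set.mem_ofPred_eq]
    refine forall_congr' fun s => ?_
    by_cases hs : s.1 ∈ B <;> simp [hs]
  have h1 : (mixtureLaw lam μ h F).real (constOn F B a) =
      ∑ b ∈ Fintype.piFinset t, ∑ j, lam j * ∫ ω : I → Ω, ∏ s : F, h j (b s) (coords ω s.1)
        ∂(Measure.infinitePi fun _ : I => μ j) := by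
    rw [measureReal_def, mixtureLaw, Measure.finsetSum_apply, ENNReal.toReal_sum fun b _ => by
        simp only [Measure.smul_apply, smul_eq_mul, Measure.dirac_apply, Set.indicator_apply]
        split_ifs <;> simp]
    rw [← Finset.sum_subset (Finset.subset_univ (Fintype.piFinset t))]
    · refine Finset.sum_congr rfl fun b hb => ?_
      rw [hmem] at hb
      simp [hb]
      exact hint b
    · intro b _ hb
      rw [hmem] at hb
      simp [hb]
  rw [h1, Finset.sum_comm]
  refine Finset.sum_congr rfl fun j _ => ?_
  rw [← Finset.mul_sum, ← integral_finsetSum _ fun b _ => Integrable.of_finite]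
  congr 1
  refine integral_congr_ae ?_
  have hae : ∀ᵐ ω ∂(Measure.infinitePi fun _ : I => μ j), ∀ s : F,
      ∑ c, h j c (coords ω s.1) = 1 := by
    rw [ae_all_iff]
    intro s
    exact (measurePreserving_precomp (μ j)
      (s.1.1.orderEmbOfFin s.1.2).injective).quasiMeasurePreserving.ae (hh j).sum_eq_one
  filter_upwards [hae] with ω hω
  rw [← Finset.prod_univ_sum t fun s c => h j c (coords ω s.1)]
  have h2 : ∀ s : F, ∑ c ∈ t s, h j c (coords ω s.1) =
      if s.1 ∈ B then h j a (coords ω s.1) else 1 := by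
    intro s
    by_cases hs : s.1 ∈ B
    · simp [ht, hs]
    · simp [ht, hs, hω s]
  simp only [h2]
  rw [Finset.prod_coe_sort F fun s => if s ∈ B then h j a (coords ω s) else 1,
    Finset.prod_ite_mem, Finset.inter_eq_right.2 hBF]

end Laws

/-! ### One-variable marginals of a spreadable array. -/

section Spread

/-- This is spreadability with `r = d`, where a subarray is a single variable. -/
lemma abs_measureReal_sub_le_of_isSpreadable {Ω₀ 𝒳 : Type*} [MeasurableSpace Ω₀] [Fintype 𝒳]
    [MeasurableSpace 𝒳] [MeasurableSingletonClass 𝒳] {I : Type*} [LinearOrder I] {d : ℕ}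
    (P : Measure Ω₀) [IsProbabilityMeasure P] {X : DSubset I d → Ω₀ → 𝒳}
    (hX : ∀ s, Measurable (X s)) {η : ℝ} (hs : IsSpreadable P X η) (s t : DSubset I d) (a : 𝒳) :
    |P.real {ω | X s ω = a} - P.real {ω | X t ω = a}| ≤ η := by
  let u : DSubset (Fin d) d := ⟨Finset.univ, by simp⟩
  have hu : ∀ s : DSubset I d, relabel s.1 s.2 u = s := by
    intro s
    apply Subtype.ext
    simp only [relabel, u]
    ext x
    simp only [Finset.mem_map, Finset.mem_univ, true_and]
    rw [← Finset.mem_coe, ← Finset.range_orderEmbOfFin s.1 s.2]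
    exact Iff.rfl
  have hm : ∀ s : DSubset I d, Measurable fun ω (v : DSubset (Fin d) d) =>
      X (relabel s.1 s.2 v) ω := fun s => measurable_pi_lambda _ fun v => hX _
  have key : ∀ s : DSubset I d, (subarrayLaw P X s.1 s.2).real {b | b u = a} =
      P.real {ω | X s ω = a} := by
    intro s
    rw [subarrayLaw, map_measureReal_apply (hm s) (Set.toFinite _).measurableSet]
    congr 1
    ext ω
    simp [hu s]
  have hp : ∀ s : DSubset I d, IsProbabilityMeasure (subarrayLaw P X s.1 s.2) := fun s =>
    Measure.isProbabilityMeasure_map (hm s).aemeasurable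
  have := hp s
  have := hp t
  rw [← key s, ← key t]
  exact (abs_sub_le_tvDist _ _ (Set.toFinite _).measurableSet).trans
    (hs d le_rfl s.1 t.1 s.2 t.2)

end Spread

/-! ### Boxes as `2^d` corners on `2d` vertices. -/

section Boxes

/-- The corner of a box selected by `e`. -/
def corner {I : Type*} [LinearOrder I] {d : ℕ} (q : Fin d × Bool → I)
    (hq : Function.Injective q) (e : Fin d → Bool) : DSubset I d :=
  ⟨Finset.univ.map ⟨fun i => q (i, e i), fun i i' h => by simpa using congrArg Prod.fst (hq h)⟩,
    by simp⟩

variable {I : Type*} [LinearOrder I] {d : ℕ} {q : Fin d × Bool → I}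

lemma mem_corner (hq : Function.Injective q) {e : Fin d → Bool} {x : I} :
    x ∈ (corner q hq e).1 ↔ ∃ i, q (i, e i) = x := by
  simp only [corner, Finset.mem_map, Finset.mem_univ, true_and]
  rfl

lemma corner_injective (hq : Function.Injective q) : Function.Injective (corner q hq) := by
  intro e e' h
  funext i
  have : q (i, e i) ∈ (corner q hq e').1 := h ▸ (mem_corner hq).2 ⟨i, rfl⟩
  obtain ⟨i', hi'⟩ := (mem_corner hq).1 this
  have := hq hi'
  simp only [Prod.mk.injEq] at this
  obtain ⟨rfl, h2⟩ := this
  exact h2.symm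

/-- The blocks are increasing, so `i ↦ q (i, e i)` is the increasing enumeration of the corner. -/
lemma coords_corner {Ω : Type*} (hq : Function.Injective q)
    (hlt : ∀ i i' : Fin d, i < i' → ∀ b b', q (i, b) < q (i', b')) (ω : I → Ω)
    (e : Fin d → Bool) : coords ω (corner q hq e) = fun i => ω (q (i, e i)) := by
  have := Finset.orderEmbOfFin_unique (corner q hq e).2 (f := fun i => q (i, e i))
    (fun i => (mem_corner hq).2 ⟨i, rfl⟩) fun i i' h => hlt i i' h _ _
  funext i
  rw [coords, ← this]

lemma IsBox.exists_corner {n d : ℕ} {B : Finset (DSubset (Fin n) d)} (hB : IsBox B) :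
    ∃ (q : Fin d × Bool → Fin n) (hq : Function.Injective q),
      (∀ i i' : Fin d, i < i' → ∀ b b', q (i, b) < q (i', b')) ∧
      B = Finset.univ.map ⟨corner q hq, corner_injective hq⟩ := by
  obtain ⟨H, hcard, hlt, hmem⟩ := hB
  -- Only consecutive `H i` are compared by hypothesis; induction on the gap passes through a point
  -- of an intermediate block.
  have hlt' : ∀ k : ℕ, ∀ i i' : Fin d, i.val + (k + 1) = i'.val → ∀ x ∈ H i, ∀ y ∈ H i', x < y := by
    intro k
    induction k with
    | zero => intro i i' h; exact hlt i i' (by omega)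
    | succ k ih =>
      intro i i' h x hx y hy
      let l : Fin d := ⟨i.val + (k + 1), by omega⟩
      obtain ⟨z, hz⟩ : (H l).Nonempty := Finset.card_pos.1 (by rw [hcard]; norm_num)
      exact (ih i l rfl x hx z hz).trans (hlt l i' (by simp only [l]; omega) z hz y hy)
  have hlt2 : ∀ i i' : Fin d, i < i' → ∀ x ∈ H i, ∀ y ∈ H i', x < y := fun i i' h =>
    hlt' (i'.val - i.val - 1) i i' (by have : i.val < i'.val := h; omega)
  choose u v huv hH using fun i => Finset.card_eq_two.1 (hcard i)
  let q : Fin d × Bool → Fin n := fun p => if p.2 then u p.1 else v p.1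
  have hqmem : ∀ i b, q (i, b) ∈ H i := by
    intro i b
    rw [hH]
    cases b <;> simp [q]
  have hqs : ∀ i, ∀ x ∈ H i, ∃ b, q (i, b) = x := by
    intro i x hx
    rw [hH, Finset.mem_insert, Finset.mem_singleton] at hx
    rcases hx with rfl | rfl
    · exact ⟨true, by simp [q]⟩
    · exact ⟨false, by simp [q]⟩
  have hqlt : ∀ i i' : Fin d, i < i' → ∀ b b', q (i, b) < q (i', b') := fun i i' h b b' =>
    hlt2 i i' h _ (hqmem _ _) _ (hqmem _ _)
  have hq : Function.Injective q := by
    rintro ⟨i, b⟩ ⟨i', b'⟩ h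
    rcases lt_trichotomy i i' with hi | rfl | hi
    · exact absurd h (hqlt i i' hi b b').ne
    · have := huv i
      have := this.symm
      cases b <;> cases b' <;> simp_all [q]
    · exact absurd h (hqlt i' i hi b' b).ne'
  refine ⟨q, hq, hqlt, ?_⟩
  ext s
  rw [hmem, Finset.mem_map]
  constructor
  · intro hs
    choose x hx using fun i => Finset.card_eq_one.1 (hs i)
    have hx' : ∀ i, x i ∈ s.1 ∧ x i ∈ H i := fun i => by
      have : x i ∈ s.1 ∩ H i := by rw [hx]; exact Finset.mem_singleton_self _
      exact Finset.mem_inter.1 this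
    choose e he using fun i => hqs i (x i) (hx' i).2
    refine ⟨e, Finset.mem_univ _, Subtype.ext ?_⟩
    refine Finset.eq_of_subset_of_card_le ?_ (by rw [s.2]; exact (corner q hq e).2.ge)
    intro y hy
    obtain ⟨i, rfl⟩ := (mem_corner hq).1 hy
    rw [he]
    exact (hx' i).1
  · rintro ⟨e, -, rfl⟩ i
    rw [Finset.card_eq_one]
    refine ⟨q (i, e i), ?_⟩
    ext y
    rw [Finset.mem_inter, Finset.mem_singleton]
    constructor
    · rintro ⟨h1, h2⟩
      obtain ⟨i', rfl⟩ := (mem_corner hq).1 h1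
      rcases lt_trichotomy i i' with hi | rfl | hi
      · exact absurd (hlt2 i i' hi _ h2 _ (hqmem _ _)) (lt_irrefl _)
      · rfl
      · exact absurd (hlt2 i' i hi _ (hqmem _ _) _ h2) (lt_irrefl _)
    · rintro rfl
      exact ⟨(mem_corner hq).2 ⟨i, rfl⟩, hqmem _ _⟩

lemma exists_isBox {n d : ℕ} (hn : 2 * d ≤ n) : ∃ B : Finset (DSubset (Fin n) d), IsBox B := by
  classical
  let H : Fin d → Finset (Fin n) := fun i =>
    {⟨2 * i.val, by omega⟩, ⟨2 * i.val + 1, by omega⟩}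
  refine ⟨Finset.univ.filter fun s => ∀ i, (s.1 ∩ H i).card = 1, H, fun i => ?_, ?_, fun s => ?_⟩
  · exact Finset.card_pair (by simp)
  · intro i i' hi x hx y hy
    simp only [H, Finset.mem_insert, Finset.mem_singleton] at hx hy
    rw [Fin.lt_def]
    rcases hx with rfl | rfl <;> rcases hy with rfl | rfl <;> simp <;> omega
  · simp

variable {Ω₀ 𝒳 J Ω : Type*} [MeasurableSpace Ω₀] [Fintype 𝒳] [MeasurableSpace 𝒳]
  [MeasurableSingletonClass 𝒳] [Fintype J] [Fintype Ω] [MeasurableSpace Ω]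
  [MeasurableSingletonClass Ω]

lemma integral_prod_corner (μ : Measure Ω) [IsProbabilityMeasure μ] (hq : Function.Injective q)
    (hlt : ∀ i i' : Fin d, i < i' → ∀ b b', q (i, b) < q (i', b')) (f : (Fin d → Ω) → ℝ) :
    ∫ ω : I → Ω, ∏ s ∈ Finset.univ.map ⟨corner q hq, corner_injective hq⟩, f (coords ω s)
      ∂(Measure.infinitePi fun _ : I => μ) = boxPow (wt μ) f := by
  simp only [Finset.prod_map, Function.Embedding.coeFn_mk, coords_corner hq hlt]
  rw [← integral_cube_eq_boxPow, ← integral_precomp μ hq]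

lemma integral_coords (μ : Measure Ω) [IsProbabilityMeasure μ] (s : DSubset I d)
    (f : (Fin d → Ω) → ℝ) :
    ∫ ω : I → Ω, f (coords ω s) ∂(Measure.infinitePi fun _ : I => μ) = avg (wt μ) f := by
  rw [← mean_eq_avg, mean, ← integral_precomp μ (s.1.orderEmbOfFin s.2).injective]
  rfl

/-- The comparison of the array with the mixture on a box. -/
lemma IsBox.approx {n : ℕ} {P : Measure Ω₀} [IsProbabilityMeasure P]
    {X : DSubset (Fin n) d → Ω₀ → 𝒳} (hX : ∀ s, Measurable (X s)) {ε : ℝ}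
    {lam : J → ℝ} (hlam : ∀ j, 0 ≤ lam j) {μ : J → Measure Ω} [∀ j, IsProbabilityMeasure (μ j)]
    {h : J → 𝒳 → (Fin d → Ω) → ℝ} (hh : ∀ j, IsPartitionOfUnity (μ j) (h j))
    (happrox : ∀ L : Finset (Fin n), L.card = 2 * d →
      tvDist (jointLaw P X (subsetsOf d L)) (mixtureLaw lam μ h (subsetsOf d L)) ≤ ε)
    {B : Finset (DSubset (Fin n) d)} (hB : IsBox B) (a : 𝒳) :
    B.card = 2 ^ d ∧
    |P.real (⋂ s ∈ B, {ω | X s ω = a}) - ∑ j, lam j * boxPow (wt (μ j)) (h j a)| ≤ ε ∧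
    ∃ s, |P.real {ω | X s ω = a} - ∑ j, lam j * avg (wt (μ j)) (h j a)| ≤ ε := by
  obtain ⟨q, hq, hlt, rfl⟩ := hB.exists_corner
  refine ⟨by simp, ?_⟩
  set L : Finset (Fin n) := Finset.univ.map ⟨q, hq⟩ with hL
  have hLc : L.card = 2 * d := by simp [hL, mul_comm]
  have hsub : ∀ e, corner q hq e ∈ subsetsOf d L := by
    intro e
    simp only [subsetsOf, Finset.mem_subtype, Finset.mem_powersetCard]
    refine ⟨fun x hx => ?_, (corner q hq e).2⟩
    obtain ⟨i, rfl⟩ := (mem_corner hq).1 hx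
    exact Finset.mem_map_of_mem ⟨q, hq⟩ (Finset.mem_univ (i, e i))
  have hprob : IsProbabilityMeasure (jointLaw P X (subsetsOf d L)) :=
    Measure.isProbabilityMeasure_map (measurable_pi_lambda (fun ω (s : subsetsOf d L) => X s.1 ω) fun s => hX s.1).aemeasurable
  have hfin := isFiniteMeasure_mixtureLaw lam μ h (subsetsOf d L)
  have key : ∀ B' ⊆ subsetsOf d L, |P.real (⋂ s ∈ B', {ω | X s ω = a}) -
      ∑ j, lam j * ∫ ω : Fin n → Ω, ∏ s ∈ B', h j a (coords ω s)
        ∂(Measure.infinitePi fun _ : Fin n => μ j)| ≤ ε := by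
    intro B' hB'
    rw [← jointLaw_constOn P hX hB', ← mixtureLaw_constOn lam hlam hh hB']
    exact (abs_sub_le_tvDist _ _ (Set.toFinite _).measurableSet).trans (happrox L hLc)
  constructor
  · have := key (Finset.univ.map ⟨corner q hq, corner_injective hq⟩) (by
      intro s hs
      obtain ⟨e, -, rfl⟩ := Finset.mem_map.1 hs
      exact hsub e)
    simpa only [integral_prod_corner _ hq hlt] using this
  -- Any corner would do.
  · refine ⟨corner q hq fun _ => true, ?_⟩
    have := key {corner q hq fun _ => true} (by simpa using hsub _)
    simpa [integral_coords] using this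

end Boxes

/-! ### The size of the constant. -/

section Constant

lemma le_exp_iterate (k : ℕ) (x : ℝ) : x ≤ Real.exp^[k] x := by
  induction k generalizing x with
  | zero => simp
  | succ k ih =>
    rw [Function.iterate_succ_apply]
    exact ((by linarith [Real.add_one_le_exp x] : x ≤ Real.exp x)).trans (ih _)

/-- All that is needed of the tower: it yields `2 ^ d / C ≤ ε` and `2 * d ≤ n`. -/
lemma le_bigC {d m : ℕ} (hm : 2 ≤ m) {ε : ℝ} (hε : 0 < ε) (hε1 : ε ≤ 1) :
    2 ^ 8 * 2 ^ d / ε ≤ bigC d m (2 * d) ε := by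
  refine le_trans ?_ (le_exp_iterate _ _)
  have h1 : d ≤ 7 * (2 * d) ^ d := by
    rcases Nat.eq_zero_or_pos d with rfl | hd
    · simp
    · have : 2 * d ≤ (2 * d) ^ d := Nat.le_self_pow hd.ne' _
      omega
  have h2 : (2 : ℝ) ^ d ≤ (m : ℝ) ^ (7 * (2 * d) ^ d) :=
    (pow_le_pow_right₀ one_le_two h1).trans
      (pow_le_pow_left₀ zero_le_two (by exact_mod_cast hm) _)
  have h3 : ε ^ 2 ≤ ε := by nlinarith
  gcongr

end Constant

/-! ### Products of numbers near a common value. -/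

section Elementary

lemma abs_prod_sub_pow_card_le {ι : Type*} (B : Finset ι) (x : ι → ℝ) {δ η : ℝ}
    (hx0 : ∀ s, 0 ≤ x s) (hx1 : ∀ s, x s ≤ 1) (hδ0 : 0 ≤ δ) (hδ1 : δ ≤ 1)
    (h : ∀ s, |x s - δ| ≤ η) : |∏ s ∈ B, x s - δ ^ B.card| ≤ B.card * η := by
  classical
  induction B using Finset.induction_on with
  | empty => simp
  | insert s B hs ih =>
    rw [Finset.prod_insert hs, Finset.card_insert_of_notMem hs, pow_succ]
    have hp1 : ∏ s ∈ B, x s ≤ 1 := Finset.prod_le_one (fun s _ => hx0 s) fun s _ => hx1 s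
    have hp0 : 0 ≤ ∏ s ∈ B, x s := Finset.prod_nonneg fun s _ => hx0 s
    have heq : x s * ∏ s ∈ B, x s - δ ^ B.card * δ =
        (x s - δ) * ∏ s ∈ B, x s + δ * (∏ s ∈ B, x s - δ ^ B.card) := by ring
    rw [heq]
    refine (abs_add_le _ _).trans ?_
    rw [abs_mul, abs_mul, abs_of_nonneg hp0, abs_of_nonneg hδ0]
    have h1 : |x s - δ| * ∏ s ∈ B, x s ≤ η :=
      (mul_le_of_le_one_right (abs_nonneg _) hp1).trans (h s)
    have h2 : δ * |∏ s ∈ B, x s - δ ^ B.card| ≤ B.card * η :=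
      (mul_le_of_le_one_left (abs_nonneg _) hδ1).trans ih
    push_cast
    linarith

lemma abs_pow_sub_pow_le_mul {x y : ℝ} (hx0 : 0 ≤ x) (hx1 : x ≤ 1) (hy0 : 0 ≤ y) (hy1 : y ≤ 1)
    (k : ℕ) : |x ^ k - y ^ k| ≤ k * |x - y| := by
  have := abs_prod_sub_pow_card_le (Finset.range k) (fun _ => x) (fun _ => hx0) (fun _ => hx1)
    hy0 hy1 fun _ => le_rfl
  simpa using this

end Elementary

/-! ### Box uniform functions, recentering and the union bound. -/

section Uniform

variable {Ω : Type*} [Fintype Ω] {k : ℕ} {w : Ω → ℝ}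

lemma avg_mem_Icc (hw : ∀ z, 0 ≤ w z) (hw1 : ∑ z, w z = 1) {d : ℕ} {f : (Fin d → Ω) → ℝ}
    (hf : ∀ x, f x ∈ Set.Icc (0 : ℝ) 1) : avg w f ∈ Set.Icc (0 : ℝ) 1 :=
  ⟨avg_nonneg hw fun x => (hf x).1, (avg_mono hw fun x => (hf x).2).trans_eq (avg_const hw1 1)⟩

lemma boxPow_mem_Icc (hw : ∀ z, 0 ≤ w z) (hw1 : ∑ z, w z = 1) {f : (Fin (k + 1) → Ω) → ℝ}
    (hf : ∀ x, f x ∈ Set.Icc (0 : ℝ) 1) : boxPow w f ∈ Set.Icc (0 : ℝ) 1 :=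
  ⟨boxPow_succ_nonneg hw f, boxPow_le_one hw hw1 fun x => by
    rw [abs_of_nonneg (hf x).1]; exact (hf x).2⟩

/-- The number of copies of a box in a box uniform function. -/
lemma abs_boxPow_sub_avg_pow_le (hw : ∀ z, 0 ≤ w z) (hw1 : ∑ z, w z = 1)
    {f : (Fin (k + 1) → Ω) → ℝ} (hf : ∀ x, f x ∈ Set.Icc (0 : ℝ) 1) {ρ : ℝ} (hρ : 0 ≤ ρ)
    (h : boxPow w (fun x => f x - avg w f) ≤ ρ ^ 2 ^ (k + 1)) :
    |boxPow w f - avg w f ^ 2 ^ (k + 1)| ≤ 2 ^ (k + 1) * ρ := by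
  have hp := avg_mem_Icc hw hw1 hf
  have hT := boxPow_mem_Icc hw hw1 hf
  have hlow := avg_pow_le_boxPow hw hw1 f
  rw [abs_of_nonneg (sub_nonneg.2 hlow)]
  have hup : boxPow w f ≤ (ρ + avg w f) ^ 2 ^ (k + 1) := by
    have := boxPow_add_le hw hρ hp.1 h (boxPow_const hw1 (avg w f)).le
    simpa using this
  set p := avg w f
  -- Truncating at `1` keeps both bases in `[0, 1]`, where the power has Lipschitz constant `2 ^ (k
  -- + 1)`.
  have hq : boxPow w f ≤ (min 1 (ρ + p)) ^ 2 ^ (k + 1) := by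
    rcases min_choice 1 (ρ + p) with h1 | h1 <;> rw [h1]
    · simpa using hT.2
    · exact hup
  have hq0 : p ≤ min 1 (ρ + p) := le_min hp.2 (by linarith)
  have h2 := abs_pow_sub_pow_le_mul (hp.1.trans hq0) (min_le_left _ _) hp.1 hp.2 (2 ^ (k + 1))
  rw [abs_of_nonneg (sub_nonneg.2 hq0)] at h2
  have h3 : min 1 (ρ + p) - p ≤ ρ := by linarith [min_le_right 1 (ρ + p)]
  have h4 := (le_abs_self _).trans h2
  push_cast at h4
  have h5 : (2 : ℝ) ^ (k + 1) * (min 1 (ρ + p) - p) ≤ 2 ^ (k + 1) * ρ := by gcongr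
  linarith

lemma abs_avg_sub_le (hw : ∀ z, 0 ≤ w z) (hw1 : ∑ z, w z = 1)
    {f : (Fin (k + 1) → Ω) → ℝ} {δ ρ : ℝ} (hρ : 0 ≤ ρ)
    (h : boxPow w (fun x => f x - δ) ≤ ρ ^ 2 ^ (k + 1)) : |avg w f - δ| ≤ ρ := by
  have h1 := (avg_pow_le_boxPow hw hw1 _).trans h
  rw [avg_sub, avg_const hw1, ← Even.pow_abs (by simp [Nat.even_pow])] at h1
  exact (pow_le_pow_iff_left₀ (abs_nonneg _) hρ (by positivity)).1 h1

lemma boxPow_sub_avg_le (hw : ∀ z, 0 ≤ w z) (hw1 : ∑ z, w z = 1)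
    {f : (Fin (k + 1) → Ω) → ℝ} {δ ρ : ℝ} (hρ : 0 ≤ ρ)
    (h : boxPow w (fun x => f x - δ) ≤ ρ ^ 2 ^ (k + 1)) :
    boxPow w (fun x => f x - avg w f) ≤ (2 * ρ) ^ 2 ^ (k + 1) := by
  have h2 : boxPow w (fun _ : Fin (k + 1) → Ω => δ - avg w f) ≤ ρ ^ 2 ^ (k + 1) := by
    rw [boxPow_const hw1, ← Even.pow_abs (by simp [Nat.even_pow]), abs_sub_comm]
    exact pow_le_pow_left₀ (abs_nonneg _) (abs_avg_sub_le hw hw1 hρ h) _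
  have := boxPow_add_le hw hρ hρ h h2
  simpa [two_mul] using this

/-- The values `f b - δ b` sum to zero wherever the weights are nonzero, so the missing one is minus
the sum over `S`. -/
lemma boxPow_sub_le_of_sum_eq_one {𝒳 : Type*} [Fintype 𝒳] [DecidableEq 𝒳] (hw : ∀ z, 0 ≤ w z)
    (f : 𝒳 → (Fin (k + 1) → Ω) → ℝ)
    (hf : ∀ x, (∀ i, w (x i) ≠ 0) → ∑ a, f a x = 1) {δ : 𝒳 → ℝ} (hδ : ∑ a, δ a = 1)
    {S : Finset 𝒳} (hS : S.card + 1 = Fintype.card 𝒳) {r : ℝ} (hr : 0 < r)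
    (h : ∀ a ∈ S, boxPow w (fun x => f a x - δ a) ≤ r ^ 2 ^ (k + 1)) (a : 𝒳) (ha : a ∉ S) :
    boxPow w (fun x => f a x - δ a) ≤ (S.card * r) ^ 2 ^ (k + 1) := by
  have huniv : insert a S = Finset.univ :=
    (Finset.card_eq_iff_eq_univ _).1 (by rw [Finset.card_insert_of_notMem ha, hS])
  have h1 := boxPow_sum_le_of_le hw S (fun _ => r) (fun _ => hr) _ h
  rw [Finset.sum_const, nsmul_eq_mul, ← boxPow_neg] at h1
  refine le_trans (le_of_eq (boxPow_congr fun x hx => ?_)) h1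
  have h2 := hf x hx
  rw [← huniv, Finset.sum_insert ha] at h2 hδ
  rw [Finset.sum_sub_distrib]
  linarith

universe u v

/-- The universe-polymorphic form of `sum_boxPow_sub_le`. -/
theorem sum_boxPow_sub_le' {J : Type u} [Fintype J] {Ω : Type v} [Fintype Ω] (lam : J → ℝ)
    (hlam : ∀ i, 0 ≤ lam i) (hlam1 : ∑ i, lam i = 1) (w : J → Ω → ℝ) (hw : ∀ i z, 0 ≤ w i z)
    (hw1 : ∀ i, ∑ z, w i z = 1) (f : J → (Fin (k + 1) → Ω) → ℝ)
    (hf : ∀ i x, f i x ∈ Set.Icc (0 : ℝ) 1) {p τ : ℝ} (hp0 : 0 ≤ p) (hp1 : p ≤ 1) (hτ : 0 ≤ τ)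
    (hmean : p - τ ^ 2 ^ k ≤ ∑ i, lam i * avg (w i) (f i))
    (hbox : ∑ i, lam i * boxPow (w i) (f i) ≤ p ^ 2 ^ (k + 1) + τ ^ 2 ^ k) :
    ∑ i, lam i * boxPow (w i) (fun x => f i x - p) ≤ 2 ^ k * 3 ^ (2 ^ (k + 1) - 1) * τ := by
  have hsum : ∀ F : J → ℝ, ∑ i : ULift.{v} J, F i.down = ∑ i, F i := fun F =>
    Equiv.ulift.sum_comp F
  have := sum_boxPow_sub_le.{u, v} k (ι := ULift.{v} J) (fun i => lam i.down)
    (fun i => hlam _) ((hsum lam).trans hlam1) (fun i => w i.down) (fun i => hw _)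
    (fun i => hw1 _) (fun i => f i.down) (fun i x => (hf _ x).1) (fun i x => (hf _ x).2) hp0 hp1 hτ
    (hmean.trans_eq (hsum fun i => lam i * avg (w i) (f i)).symm)
    ((hsum fun i => lam i * boxPow (w i) (f i)).trans_le hbox)
  exact (hsum fun i => lam i * boxPow (w i) fun x => f i x - p).symm.trans_le this

/-- A union bound over the weighted index set. -/
lemma one_sub_le_sum_filter {J 𝒳 : Type*} [Fintype J] (lam : J → ℝ) (hlam : ∀ j, 0 ≤ lam j)
    (hlam1 : ∑ j, lam j = 1) (S : Finset 𝒳) (T : J → 𝒳 → ℝ) (hT : ∀ j a, 0 ≤ T j a) {t A : ℝ}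
    (ht : 0 < t) (h : ∀ a ∈ S, ∑ j, lam j * T j a ≤ A) (G : Finset J)
    (hG : ∀ j, j ∉ G → ∃ a ∈ S, t ≤ T j a) :
    1 - S.card * A / t ≤ ∑ j ∈ G, lam j := by
  classical
  have h1 : ∑ j ∈ Gᶜ, lam j ≤ S.card * A / t := by
    rw [le_div_iff₀ ht, Finset.sum_mul]
    calc ∑ j ∈ Gᶜ, lam j * t ≤ ∑ j ∈ Gᶜ, ∑ a ∈ S, lam j * T j a := by
          refine Finset.sum_le_sum fun j hj => ?_
          obtain ⟨a, ha, hta⟩ := hG j (Finset.mem_compl.1 hj)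
          exact (mul_le_mul_of_nonneg_left hta (hlam j)).trans
            (Finset.single_le_sum (f := fun a => lam j * T j a)
              (fun a _ => mul_nonneg (hlam j) (hT j a)) ha)
      _ ≤ ∑ j, ∑ a ∈ S, lam j * T j a :=
          Finset.sum_le_sum_of_subset_of_nonneg (Finset.subset_univ _) fun j _ _ =>
            Finset.sum_nonneg fun a _ => mul_nonneg (hlam j) (hT j a)
      _ = ∑ a ∈ S, ∑ j, lam j * T j a := Finset.sum_comm
      _ ≤ ∑ _a ∈ S, A := Finset.sum_le_sum h
      _ = S.card * A := by simp
  have h2 := Finset.sum_add_sum_compl G lam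
  linarith

end Uniform

/-! ### Choice of exponents and thresholds. -/

section Parameters

/-- The right side is `τ ^ 2 ^ k` for the `τ` used in the main argument. It suffices that `ε + θ ≤ s
^ 12 ^ (k + 1)` and that `12 ^ (k + 1)` exceeds the exponent `(2 ^ (k + 1) + 1) * 2 ^ k`. -/
lemma two_mul_add_le_pow {k : ℕ} {ε θ s : ℝ} (hε : 0 ≤ ε) (hθ : 0 ≤ θ)
    (hs : s = ε ^ ((1 : ℝ) / 12 ^ (k + 1)) + θ ^ ((1 : ℝ) / 12 ^ (k + 1))) (hs1 : s ≤ 1) :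
    2 * (ε + θ) ≤ (2 * s ^ (2 ^ (k + 1) + 1)) ^ 2 ^ k := by
  have hroot : ∀ x : ℝ, 0 ≤ x → (x ^ ((1 : ℝ) / 12 ^ (k + 1))) ^ 12 ^ (k + 1) = x := by
    intro x hx
    have := Real.rpow_inv_natCast_pow hx (n := 12 ^ (k + 1)) (by positivity)
    simpa using this
  have hu := Real.rpow_nonneg hε ((1 : ℝ) / 12 ^ (k + 1))
  have hv := Real.rpow_nonneg hθ ((1 : ℝ) / 12 ^ (k + 1))
  have hs0 : 0 ≤ s := by rw [hs]; exact add_nonneg hu hv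
  have h1 : ε + θ ≤ s ^ 12 ^ (k + 1) := by
    have := pow_add_pow_le hu hv (n := 12 ^ (k + 1)) (by positivity)
    rwa [hroot ε hε, hroot θ hθ, ← hs] at this
  have hexp : (2 ^ (k + 1) + 1) * 2 ^ k ≤ 12 ^ (k + 1) := by
    calc (2 ^ (k + 1) + 1) * 2 ^ k ≤ (2 ^ (k + 1) + 2 ^ (k + 1)) * 2 ^ k := by
          gcongr
          exact Nat.one_le_two_pow
      _ = 4 ^ (k + 1) := by
          rw [show (4 : ℕ) = 2 * 2 by norm_num, mul_pow]
          ring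
      _ ≤ 12 ^ (k + 1) := Nat.pow_le_pow_left (by norm_num) _
  rw [mul_pow, ← pow_mul]
  have h2 : s ^ 12 ^ (k + 1) ≤ s ^ ((2 ^ (k + 1) + 1) * 2 ^ k) :=
    pow_le_pow_of_le_one hs0 hs1 hexp
  have h3 : (2 : ℝ) ≤ 2 ^ 2 ^ k := le_self_pow₀ one_le_two (by positivity)
  exact mul_le_mul h3 (h1.trans h2) (add_nonneg hε hθ) (by positivity)

/-- With `K = 2 ^ (k + 1)`, the threshold is at least `4 * s` and `3 ^ (K - 1) ≤ 4 ^ K`; so `s ^ (K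
+ 1)` over the `K`-th power of the threshold leaves one factor `s`. -/
lemma markov_bound {k m c : ℕ} (hm : 1 ≤ m) (hc : c ≤ m) {s : ℝ} (hs : 0 < s) :
    c * (2 ^ k * 3 ^ (2 ^ (k + 1) - 1) * (2 * s ^ (2 ^ (k + 1) + 1))) /
      (2 ^ (k + 1 + 7) * (m : ℝ) ^ 3 * s / (2 * m)) ^ 2 ^ (k + 1) ≤
        2 ^ (k + 1 + 7) * (m : ℝ) ^ 3 * s := by
  have hm' : (1 : ℝ) ≤ m := by exact_mod_cast hm
  have hm0 : (0 : ℝ) < m := by linarith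
  have hc' : (c : ℝ) ≤ m := by exact_mod_cast hc
  rw [div_le_iff₀ (by positivity)]
  set K := 2 ^ (k + 1) with hK
  have h3 : (3 : ℝ) ^ (K - 1) ≤ 4 ^ K :=
    (pow_le_pow_left₀ (by norm_num) (by norm_num) _).trans
      (pow_le_pow_right₀ (by norm_num) (Nat.sub_le _ _))
  have hr : 4 * s ≤ 2 ^ (k + 1 + 7) * (m : ℝ) ^ 3 * s / (2 * m) := by
    rw [le_div_iff₀ (by positivity)]
    have h4 : (8 : ℝ) ≤ 2 ^ (k + 1 + 7) := by
      calc (8 : ℝ) = 2 ^ 3 := by norm_num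
        _ ≤ _ := pow_le_pow_right₀ one_le_two (by omega)
    have h5 : (m : ℝ) ≤ m ^ 3 := le_self_pow₀ hm' (by norm_num)
    calc 4 * s * (2 * m) = 8 * m * s := by ring
      _ ≤ _ := by gcongr
  calc c * (2 ^ k * 3 ^ (K - 1) * (2 * s ^ (K + 1)))
      ≤ m ^ 3 * (2 ^ k * 4 ^ K * (2 * s ^ (K + 1))) := by
        have h5 : (m : ℝ) ≤ m ^ 3 := le_self_pow₀ hm' (by norm_num)
        have := hc'.trans h5
        gcongr
    _ = 2 ^ (k + 1) * m ^ 3 * s * (4 * s) ^ K := by ring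
    _ ≤ _ := by
        have h6 : (2 : ℝ) ^ (k + 1) ≤ 2 ^ (k + 1 + 7) := pow_le_pow_right₀ one_le_two (by omega)
        exact mul_le_mul (by gcongr) (pow_le_pow_left₀ (by positivity) hr _) (by positivity)
          (by positivity)

end Parameters

/-! ### The two implications. -/

section Main

variable {n k : ℕ} {𝒳 Ω₀ J Ω : Type*} [Fintype 𝒳] [MeasurableSpace 𝒳]
  [MeasurableSingletonClass 𝒳] [MeasurableSpace Ω₀] {P : Measure Ω₀} [IsProbabilityMeasure P]
  {X : DSubset (Fin n) (k + 1) → Ω₀ → 𝒳} [Fintype J] [Fintype Ω] [MeasurableSpace Ω]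
  [MeasurableSingletonClass Ω] {lam : J → ℝ} {μ : J → Measure Ω}
  [∀ j, IsProbabilityMeasure (μ j)] {h : J → 𝒳 → (Fin (k + 1) → Ω) → ℝ} {δ : 𝒳 → ℝ} {ε ρ η : ℝ}

/-- Box statistics of a mixture that is mostly box uniform. -/
lemma IsUniformSet.abs_sum_boxPow_sub_le (hlam : ∀ j, 0 ≤ lam j) (hlam1 : ∑ j, lam j = 1)
    (hh : ∀ j a x, h j a x ∈ Set.Icc (0 : ℝ) 1) {G : Finset J} (hρ : 0 ≤ ρ)
    (hG : IsUniformSet lam μ h δ ρ G) (a : 𝒳) (hδ : δ a ∈ Set.Icc (0 : ℝ) 1) :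
    |∑ j, lam j * boxPow (wt (μ j)) (h j a) - δ a ^ 2 ^ (k + 1)| ≤
      2 ^ (k + 1) * (2 * ρ) + ρ := by
  classical
  set T : J → ℝ := fun j => boxPow (wt (μ j)) (h j a)
  have hT : ∀ j, T j ∈ Set.Icc (0 : ℝ) 1 := fun j =>
    boxPow_mem_Icc (wt_nonneg _) (sum_wt _) (hh j a)
  have hD0 : 0 ≤ δ a ^ 2 ^ (k + 1) := pow_nonneg hδ.1 _
  have hD1 : δ a ^ 2 ^ (k + 1) ≤ 1 := pow_le_one₀ hδ.1 hδ.2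
  -- One `ρ` comes from the box norm, the other from moving the mean to `δ a`.
  have hgood : ∀ j ∈ G, |T j - δ a ^ 2 ^ (k + 1)| ≤ 2 ^ (k + 1) * (2 * ρ) := by
    intro j hj
    obtain ⟨h1, h2⟩ := hG.2 j hj a
    rw [boxNorm_le_iff _ _ hρ] at h2
    simp only [mean_eq_avg] at h1 h2
    have h3 := abs_boxPow_sub_avg_pow_le (wt_nonneg _) (sum_wt _) (hh j a) hρ h2
    have hp := avg_mem_Icc (wt_nonneg (μ j)) (sum_wt _) (hh j a)
    have h4 := abs_pow_sub_pow_le_mul hp.1 hp.2 hδ.1 hδ.2 (2 ^ (k + 1))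
    push_cast at h4
    have h5 : (2 : ℝ) ^ (k + 1) * |avg (wt (μ j)) (h j a) - δ a| ≤ 2 ^ (k + 1) * ρ := by gcongr
    have h6 := abs_sub_le (T j) (avg (wt (μ j)) (h j a) ^ 2 ^ (k + 1)) (δ a ^ 2 ^ (k + 1))
    linarith
  have hbad : ∀ j, |T j - δ a ^ 2 ^ (k + 1)| ≤ 1 := fun j => by
    rw [abs_le]
    constructor <;> linarith [(hT j).1, (hT j).2]
  have hmass : ∑ j ∈ Gᶜ, lam j ≤ ρ := by
    have := Finset.sum_add_sum_compl G lam
    linarith [hG.1]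
  have hmass' : ∑ j ∈ G, lam j ≤ 1 := by
    rw [← hlam1]
    exact Finset.sum_le_sum_of_subset_of_nonneg (Finset.subset_univ _) fun j _ _ => hlam j
  have heq : ∑ j, lam j * T j - δ a ^ 2 ^ (k + 1) =
      ∑ j, lam j * (T j - δ a ^ 2 ^ (k + 1)) := by
    simp only [mul_sub, Finset.sum_sub_distrib, ← Finset.sum_mul, hlam1, one_mul]
  rw [heq]
  calc |∑ j, lam j * (T j - δ a ^ 2 ^ (k + 1))|
      ≤ ∑ j, lam j * |T j - δ a ^ 2 ^ (k + 1)| :=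
        (Finset.abs_sum_le_sum_abs _ _).trans_eq
          (Finset.sum_congr rfl fun j _ => by rw [abs_mul, abs_of_nonneg (hlam j)])
    _ = ∑ j ∈ G, lam j * |T j - δ a ^ 2 ^ (k + 1)| +
        ∑ j ∈ Gᶜ, lam j * |T j - δ a ^ 2 ^ (k + 1)| := (Finset.sum_add_sum_compl G _).symm
    _ ≤ ∑ j ∈ G, lam j * (2 ^ (k + 1) * (2 * ρ)) + ∑ j ∈ Gᶜ, lam j * 1 := by
        gcongr with j hj j hj
        · exact hlam j
        · exact hgood j hj
        · exact hlam j
        · exact hbad j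
    _ = (∑ j ∈ G, lam j) * (2 ^ (k + 1) * (2 * ρ)) + ∑ j ∈ Gᶜ, lam j := by
        simp [Finset.sum_mul]
    _ ≤ 1 * (2 ^ (k + 1) * (2 * ρ)) + ρ := by gcongr
    _ = _ := by ring

variable (hX : ∀ s, Measurable (X s)) (hlam : ∀ j, 0 ≤ lam j) (hlam1 : ∑ j, lam j = 1)
  (hh : ∀ j, IsPartitionOfUnity (μ j) (h j))
  (happrox : ∀ L : Finset (Fin n), L.card = 2 * (k + 1) →
    tvDist (jointLaw P X (subsetsOf (k + 1) L)) (mixtureLaw lam μ h (subsetsOf (k + 1) L)) ≤ ε)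
  (hδ : ∀ a, δ a ∈ Set.Icc (0 : ℝ) 1) (hδX : ∀ s a, |P.real {ω | X s ω = a} - δ a| ≤ η)
  (hη : 2 ^ (k + 1) * η ≤ ε)

include hX hlam hlam1 hh happrox hδ hδX hη

theorem boxIndependent_of_isUniformSet [Nonempty 𝒳] (hρ : 0 ≤ ρ) {G : Finset J}
    (hG : IsUniformSet lam μ h δ ρ G) :
    BoxIndependent P X (2 ^ (k + 1) * (2 * ε + 4 * ρ)) := by
  classical
  obtain ⟨a₀⟩ := ‹Nonempty 𝒳›
  -- The estimate holds for every value, so the omitted one is arbitrary.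
  refine ⟨Finset.univ.erase a₀, ?_, fun B hB a _ => ?_⟩
  · rw [Finset.card_erase_add_one (Finset.mem_univ _), Finset.card_univ]
  obtain ⟨hc, h1, -⟩ := hB.approx hX hlam hh happrox a
  have h2 := hG.abs_sum_boxPow_sub_le hlam hlam1 (fun j => (hh j).mem_Icc) hρ a (hδ a)
  have h3 := abs_prod_sub_pow_card_le B (fun s => P.real {ω | X s ω = a})
    (fun s => measureReal_nonneg) (fun s => measureReal_le_one) (hδ a).1 (hδ a).2 (hδX · a)
  rw [hc] at h3
  push_cast at h3
  have hK : (1 : ℝ) ≤ 2 ^ (k + 1) := one_le_pow₀ one_le_two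
  have hε : 0 ≤ ε := (abs_nonneg _).trans h1
  have h4 : ε ≤ 2 ^ (k + 1) * ε := le_mul_of_one_le_left hε hK
  have h5 : ρ ≤ 2 ^ (k + 1) * ρ := le_mul_of_one_le_left hρ hK
  rw [abs_le] at *
  constructor <;> linarith

theorem exists_isUniformSet_of_boxIndependent (hk : 2 * (k + 1) ≤ n) (hε : 0 < ε) {m : ℕ}
    (hm : 1 ≤ m) (hcard : Fintype.card 𝒳 = m) (hδ1 : ∑ a, δ a = 1) {θ : ℝ} (hθ : 0 < θ)
    (hη0 : 0 ≤ η) (hbox : BoxIndependent P X θ) :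
    ∃ G : Finset J, IsUniformSet lam μ h δ (2 ^ (k + 1 + 7) * (m : ℝ) ^ 3 *
      (ε ^ ((1 : ℝ) / 12 ^ (k + 1)) + θ ^ ((1 : ℝ) / 12 ^ (k + 1)))) G := by
  classical
  set s := ε ^ ((1 : ℝ) / 12 ^ (k + 1)) + θ ^ ((1 : ℝ) / 12 ^ (k + 1)) with hs
  set R := 2 ^ (k + 1 + 7) * (m : ℝ) ^ 3 * s with hR
  have hm' : (1 : ℝ) ≤ m := by exact_mod_cast hm
  have hs0 : 0 < s := add_pos (Real.rpow_pos_of_pos hε _) (Real.rpow_pos_of_pos hθ _)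
  have hR0 : 0 < R := by positivity
  have hsR : s ≤ R := le_mul_of_one_le_left hs0.le
    (one_le_mul_of_one_le_of_one_le (one_le_pow₀ one_le_two) (one_le_pow₀ hm'))
  have hw : ∀ j z, 0 ≤ wt (μ j) z := fun j => wt_nonneg _
  have hw1 : ∀ j, ∑ z, wt (μ j) z = 1 := fun j => sum_wt _
  have hmem : ∀ j a x, h j a x ∈ Set.Icc (0 : ℝ) 1 := fun j => (hh j).mem_Icc
  -- For `R ≥ 1` everything holds trivially with `G = J`; otherwise `s ≤ R < 1`.
  by_cases hR1 : 1 ≤ R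
  · refine ⟨Finset.univ, by rw [hlam1]; linarith, fun j _ a => ?_⟩
    have hp := avg_mem_Icc (hw j) (hw1 j) (hmem j a)
    rw [boxNorm_le_iff _ _ hR0.le]
    simp only [mean_eq_avg]
    refine ⟨le_trans ?_ hR1, (boxPow_le_one (hw j) (hw1 j) fun x => ?_).trans (one_le_pow₀ hR1)⟩
    · rw [abs_le]
      constructor <;> linarith [(hδ a).1, (hδ a).2, hp.1, hp.2]
    · rw [abs_le]
      constructor <;> linarith [(hmem j a x).1, (hmem j a x).2, hp.1, hp.2]
  push Not at hR1
  obtain ⟨S, hS, hSB⟩ := hbox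
  obtain ⟨B, hB⟩ := exists_isBox hk
  set τ := 2 * s ^ (2 ^ (k + 1) + 1) with hτ
  have hτ0 : 0 ≤ τ := by positivity
  have hτk : 2 * (ε + θ) ≤ τ ^ 2 ^ k := two_mul_add_le_pow hε.le hθ.le hs (by linarith)
  set A : ℝ := 2 ^ k * 3 ^ (2 ^ (k + 1) - 1) * τ with hA
  have hηε : η ≤ ε := (le_mul_of_one_le_left hη0 (one_le_pow₀ one_le_two)).trans hη
  have hclose : ∀ a ∈ S, ∑ j, lam j * boxPow (wt (μ j)) (fun x => h j a x - δ a) ≤ A := by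
    intro a ha
    obtain ⟨hc, h1, t, h2⟩ := hB.approx hX hlam hh happrox a
    have h3 := abs_prod_sub_pow_card_le B (fun s => P.real {ω | X s ω = a})
      (fun s => measureReal_nonneg) (fun s => measureReal_le_one) (hδ a).1 (hδ a).2 (hδX · a)
    have h4 := hSB B hB a ha
    have h5 := hδX t a
    rw [hc] at h3
    push_cast at h3
    rw [abs_le] at h1 h2 h3 h4 h5
    -- The mean error is `ε + η ≤ 2ε`; the box error is `ε + θ + 2 ^ (k + 1) * η ≤ 2ε + θ`. Both are
    -- below `τ ^ 2 ^ k`.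
    exact sum_boxPow_sub_le' lam hlam hlam1 _ hw hw1 (fun j => h j a) (fun j => hmem j a)
      (hδ a).1 (hδ a).2 hτ0 (by linarith [h2.2, h5.1]) (by linarith [h1.1, h3.2, h4.2])
  have hr0 : 0 < R / (2 * m) := by positivity
  have hrm : m * (R / (2 * m)) = R / 2 := by field_simp
  have hr : R / (2 * m) ≤ R / 2 := by
    rw [← hrm]
    exact le_mul_of_one_le_left hr0.le hm'
  -- The factor `m` pays for summing over `S` at the missing value, the factor `2` for recentering
  -- from `δ a` to the mean.
  set r := R / (2 * m) with hr_def
  have hSm : S.card ≤ m := by omega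
  refine ⟨Finset.univ.filter fun j => ∀ a ∈ S,
    boxPow (wt (μ j)) (fun x => h j a x - δ a) ≤ r ^ 2 ^ (k + 1), ?_, fun j hj a => ?_⟩
  · refine le_trans ?_ (one_sub_le_sum_filter lam hlam hlam1 S
      (fun j a => boxPow (wt (μ j)) fun x => h j a x - δ a)
      (fun j a => boxPow_succ_nonneg (hw j) _) (pow_pos hr0 (2 ^ (k + 1))) hclose _ ?_)
    · have := markov_bound (k := k) hm hSm hs0
      rw [← hR, ← hτ, ← hA, ← hr_def] at this
      linarith
    · intro j hj
      simp only [Finset.mem_filter, Finset.mem_univ, true_and, not_forall, not_le] at hj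
      obtain ⟨a, ha, h1⟩ := hj
      exact ⟨a, ha, h1.le⟩
  · simp only [Finset.mem_filter, Finset.mem_univ, true_and] at hj
    have hall : boxPow (wt (μ j)) (fun x => h j a x - δ a) ≤ (R / 2) ^ 2 ^ (k + 1) := by
      by_cases ha : a ∈ S
      · exact (hj a ha).trans (pow_le_pow_left₀ hr0.le hr _)
      · refine (boxPow_sub_le_of_sum_eq_one (hw j) (h j) ((ae_pi_iff _).1 (hh j).sum_eq_one) hδ1
          (S := S) (by rw [hS]) hr0 hj a ha).trans (pow_le_pow_left₀ (by positivity) ?_ _)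
        rw [← hrm]
        have : (S.card : ℝ) ≤ m := by exact_mod_cast hSm
        gcongr
    rw [boxNorm_le_iff _ _ hR0.le]
    simp only [mean_eq_avg]
    have h1 := abs_avg_sub_le (hw j) (hw1 j) (by linarith) hall
    have h2 := boxPow_sub_avg_le (hw j) (hw1 j) (by linarith) hall
    rw [mul_div_cancel₀ R two_ne_zero] at h2
    exact ⟨by linarith, h2⟩

end Main

end RandomArray

end
-- The proposition, with `η = 1 / C`.
theorem proposition8p3
    (d m : ℕ) (hd : 2 ≤ d) (hm : 2 ≤ m) (ε : ℝ) (hε : 0 < ε) (hε1 : ε ≤ 1)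
    (n : ℕ) (hdn : d ≤ n) (hn : RandomArray.bigC d m (2 * d) ε ≤ n)
    {𝒳 : Type*} [Fintype 𝒳] [MeasurableSpace 𝒳] [MeasurableSingletonClass 𝒳]
    (h𝒳 : Fintype.card 𝒳 = m)
    -- the random array `X` on `[n]`
    {Ω₀ : Type*} [MeasurableSpace Ω₀] (P : MeasureTheory.Measure Ω₀)
    [MeasureTheory.IsProbabilityMeasure P]
    (X : RandomArray.DSubset (Fin n) d → Ω₀ → 𝒳) (hX : ∀ s, Measurable (X s))
    (hspread : RandomArray.IsSpreadable P X (1 / RandomArray.bigC d m (2 * d) ε))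
    -- a distributional decomposition of `X` for the parameters `d, m, ε` and `k = 2d`
    {J : Type*} [Fintype J] [Nonempty J] (hJ : (Fintype.card J : ℝ) ≤ RandomArray.bigC d m (2 * d) ε)
    {Ω : Type*} [Fintype Ω] [Nonempty Ω] [MeasurableSpace Ω] [MeasurableSingletonClass Ω]
    (hΩ : (Fintype.card Ω : ℝ) ≤ RandomArray.bigC d m (2 * d) ε)
    (lam : J → ℝ) (hlam : ∀ j, 0 < lam j) (hlam1 : ∑ j, lam j = 1)
    (μ : J → MeasureTheory.Measure Ω) [∀ j, MeasureTheory.IsProbabilityMeasure (μ j)]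
    (h : J → 𝒳 → (Fin d → Ω) → ℝ) (hh : ∀ j, RandomArray.IsPartitionOfUnity (μ j) (h j))
    (happrox : ∀ L : Finset (Fin n), L.card = 2 * d →
      RandomArray.tvDist (RandomArray.jointLaw P X (RandomArray.subsetsOf d L))
        (RandomArray.mixtureLaw lam μ h (RandomArray.subsetsOf d L)) ≤ ε)
    (δ : 𝒳 → ℝ) (hδ : ∀ a, δ a = P.real {ω | X (RandomArray.initial hdn) ω = a}) :
    (∀ ρ : ℝ, 0 < ρ →
      (∃ G : Finset J, RandomArray.IsUniformSet lam μ h δ ρ G) →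
      RandomArray.BoxIndependent P X (2 ^ d * (2 * ε + 4 * ρ))) ∧
    (∀ θ : ℝ, 0 < θ →
      RandomArray.BoxIndependent P X θ →
      ∃ G : Finset J, RandomArray.IsUniformSet lam μ h δ
        (2 ^ (d + 7) * (m : ℝ) ^ 3 * (ε ^ ((1 : ℝ) / 12 ^ d) + θ ^ ((1 : ℝ) / 12 ^ d))) G) := by
  obtain ⟨k, rfl⟩ : ∃ k, d = k + 1 := ⟨d - 1, by omega⟩
  have hlam0 : ∀ j, 0 ≤ lam j := fun j => (hlam j).le
  set C := RandomArray.bigC (k + 1) m (2 * (k + 1)) ε with hC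
  have hCε : 2 ^ 8 * 2 ^ (k + 1) / ε ≤ C := RandomArray.le_bigC hm hε hε1
  have hC0 : 0 < C := lt_of_lt_of_le (by positivity) hCε
  have hη : 2 ^ (k + 1) * (1 / C) ≤ ε := by
    rw [div_le_iff₀ hε] at hCε
    rw [mul_one_div, div_le_iff₀ hC0]
    have : (0 : ℝ) < 2 ^ (k + 1) := by positivity
    linarith
  have hkn : 2 * (k + 1) ≤ n := by
    have h1 : (2 : ℝ) ^ 8 * 2 ^ (k + 1) ≤ 2 ^ 8 * 2 ^ (k + 1) / ε :=
      le_div_self (by positivity) hε hε1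
    have h2 : ((k + 1 : ℕ) : ℝ) < 2 ^ (k + 1) := by exact_mod_cast Nat.lt_two_pow_self
    have h3 : ((2 * (k + 1) : ℕ) : ℝ) ≤ n := by
      push_cast at h2 ⊢
      linarith
    exact_mod_cast h3
  have hδ01 : ∀ a, δ a ∈ Set.Icc (0 : ℝ) 1 := fun a => by
    rw [hδ]
    exact ⟨MeasureTheory.measureReal_nonneg, MeasureTheory.measureReal_le_one⟩
  have hδX : ∀ s a, |P.real {ω | X s ω = a} - δ a| ≤ 1 / C := fun s a => by
    rw [hδ]
    exact RandomArray.abs_measureReal_sub_le_of_isSpreadable P hX hspread _ _ a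
  have hδ1 : ∑ a, δ a = 1 := by
    have := MeasureTheory.Measure.isProbabilityMeasure_map (μ := P)
      (hX (RandomArray.initial hdn)).aemeasurable
    rw [← RandomArray.sum_wt (P.map (X (RandomArray.initial hdn)))]
    refine Finset.sum_congr rfl fun a _ => ?_
    rw [hδ, RandomArray.wt, MeasureTheory.map_measureReal_apply (hX _)
      (measurableSet_singleton a)]
    rfl
  constructor
  · rintro ρ hρ ⟨G, hG⟩
    have : Nonempty 𝒳 := Fintype.card_pos_iff.1 (by omega)
    exact RandomArray.boxIndependent_of_isUniformSet hX hlam0 hlam1 hh happrox hδ01 hδX hη hρ.le hG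
  · intro θ hθ hbox
    exact RandomArray.exists_isUniformSet_of_boxIndependent hX hlam0 hlam1 hh happrox hδ01 hδX hη
      hkn hε (by omega) h𝒳 hδ1 hθ (by positivity) hbox
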